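/- Let $T=\mathbb R/\mathbb Z\times\mathbb R/\mathbb Z$ be the closed torus with its standard smooth structure and the orientation induced from $\mathbb R^2$, and let $\hat\pi$ be the set of free homotopy classes of loops on $T$. Let $a,b\in\pi_1(T,0)$ be the classes of $t\mapsto(t,0)$ and $t\mapsto(0,t)$; write $a^ib^j$ also for the free homotopy class of this element. Let $R$ be a commutative ring (for instance $\mathbb Z$ or $\mathbb Q$), and let $R\hat\pi$ be the free $R$-module with basis $\hat\pi$. Call two smooth loops $\alpha,\beta:\mathbb R/\mathbb Z\to T$ transverse if for all $(s,t)$ with $\alpha(s)=\beta(t)$ the vectors $\alpha'(s),\beta'(t)$ span the tangent space at that point. The Goldman bracket is the $R$-bilinear map $[-,-]:R\hat\pi\times R\hat\pi\to R\hat\pi$ given on free homotopy classes $x,y\in\hat\pi$ by $$[x,y]=\sum_{p}\epsilon(p)\,\alpha *_p\beta ,$$ where $\alpha,\beta$ are transverse representatives of $x,y$, the sum is over the intersections $p$, i.e. the pairs $(s,t)$ with $\alpha(s)=\beta(t)$, $\epsilon(p)=1$ if $(\alpha'(s),\beta'(t))$ is a positively oriented basis of the tangent space and $\epsilon(p)=-1$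 otherwise, and $\alpha *_p\beta$ is the free homotopy class of the loop that starts at $p$, runs once through $\alpha$ and then once through $\beta$. Then any two classes in $\hat\pi$ have transverse representatives; for every transverse pair the sum is finite, and its value $[x,y]$ does not depend on the pair of representatives; the map $\mathbb Z^2\to\hat\pi$, $(i,j)\mapsto a^ib^j$, is a bijection; and for all $i,j,k,l\in\mathbb Z$ $$[a^ib^j,\,a^kb^l]=(il-jk)\,a^{i+k}b^{j+l}.$$ -/

import Mathlib

open scoped Manifold ContDiff

noncomputable section

namespace Goldman

/-! ### Loops and free homotopy classes -/

/-- A loop in `X` is a continuous map from the circle `ℝ / ℤ` to `X`. -/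
abbrev Loop (X : Type*) [TopologicalSpace X] := C(UnitAddCircle, X)

/-- The set of free homotopy classes of loops in `X`. -/
def FreeLoopClass (X : Type*) [TopologicalSpace X] : Type _ :=
  Quotient (⟨ContinuousMap.Homotopic, ContinuousMap.Homotopic.equivalence⟩ : Setoid (Loop X))

/-- The free homotopy class of a loop. -/
def freeClass {X : Type*} [TopologicalSpace X] (α : Loop X) : FreeLoopClass X :=
  Quotient.mk _ α

/-- The loop `ℝ / ℤ → X` obtained from a closed path `[0, 1] → X`. -/
def closeUp {X : Type*} [TopologicalSpace X] {x : X} (γ : Path x x) : Loop X where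
  toFun := AddCircle.liftIco 1 0 γ.extend
  continuous_toFun :=
    AddCircle.liftIco_zero_continuous (by simp) γ.continuous_extend.continuousOn

theorem closeUp_coe {X : Type*} [TopologicalSpace X] {x : X} (γ : Path x x) {t : ℝ}
    (ht : t ∈ Set.Ico (0 : ℝ) 1) :
    closeUp γ (t : UnitAddCircle) = γ ⟨t, ht.1, ht.2.le⟩ := by
  change AddCircle.liftIco 1 0 γ.extend (t : UnitAddCircle) = _
  rw [AddCircle.liftIco_zero_coe_apply ht]
  exact γ.extend_apply ⟨ht.1, ht.2.le⟩

theorem closeUp_homotopic {X : Type*} [TopologicalSpace X] {x : X} {γ γ' : Path x x}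
    (h : γ.Homotopic γ') : (closeUp γ).Homotopic (closeUp γ') := by
  obtain ⟨F⟩ := h
  let G : Path (ContinuousMap.const unitInterval x) (ContinuousMap.const unitInterval x) :=
    { toContinuousMap := (F.toContinuousMap.comp ContinuousMap.prodSwap).curry
      source' := by ext t; exact F.source t
      target' := by ext t; exact F.target t }
  have key : ∀ (c : UnitAddCircle) (r : unitInterval) (δ : Path x x),
      (∀ t, F (r, t) = δ t) → closeUp G c r = closeUp δ c := by
    intro c r δ hδ
    obtain ⟨t, ht, rfl⟩ : ∃ t ∈ Set.Ico (0 : ℝ) 1, (t : UnitAddCircle) = c :=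
      ⟨AddCircle.equivIco 1 0 c, by simpa using (AddCircle.equivIco 1 0 c).2,
        AddCircle.coe_equivIco⟩
    rw [closeUp_coe G ht, closeUp_coe δ ht]
    exact hδ _
  refine ⟨{ toContinuousMap := (closeUp G).uncurry.comp ContinuousMap.prodSwap
            map_zero_left := fun c => key c 0 γ fun t => F.apply_zero t
            map_one_left := fun c => key c 1 γ' fun t => F.apply_one t }⟩

/-- The free homotopy class of an element of the fundamental group. -/
def freeClassOfPi1 {X : Type*} [TopologicalSpace X] {x : X} (g : FundamentalGroup X x) :
    FreeLoopClass X :=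
  Quotient.lift (s := Path.Homotopic.setoid x x) (fun γ : Path x x => freeClass (closeUp γ))
    (fun _ _ h => Quotient.sound (closeUp_homotopic h)) (FundamentalGroup.toPath g)

/-- The closed path which runs once through the loop `α`, starting at the parameter `s`. -/
def loopFrom {X : Type*} [TopologicalSpace X] (α : Loop X) (s : UnitAddCircle) :
    Path (α s) (α s) where
  toFun t := α (s + ((t : ℝ) : UnitAddCircle))
  continuous_toFun := α.continuous.comp
    (continuous_const.add ((AddCircle.continuous_mk' 1).comp continuous_subtype_val))
  source' := by simp
  target' := by
    have h : ((1 : ℝ) : UnitAddCircle) = 0 := AddCircle.coe_period 1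
    simp [h]

/-- The loop `α *ₚ β` for `p = α s = β t`: run once through `α` from `p` to `p`, then once
through `β` from `p` to `p`. -/
def loopProduct {X : Type*} [TopologicalSpace X] (α β : Loop X) (s t : UnitAddCircle)
    (h : α s = β t) : Loop X :=
  closeUp ((loopFrom α s).trans ((loopFrom β t).cast h h))

/-! ### Oriented surfaces -/

/-- A smooth surface (without boundary) with an oriented atlas: all transition maps have
positive Jacobian. -/
class OrientedSurface (M : Type*) [TopologicalSpace M] [ChartedSpace (ℝ × ℝ) M] : Prop
    extends IsManifold 𝓘(ℝ, ℝ × ℝ) ∞ M where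
  jacobian_pos : ∀ e ∈ atlas (ℝ × ℝ) M, ∀ e' ∈ atlas (ℝ × ℝ) M,
    ∀ x ∈ (e.symm.trans e').source, 0 < (fderiv ℝ (e.symm.trans e') x).det

/-- A loop is smooth if it is smooth as a `1`-periodic function on `ℝ`. -/
def IsSmoothLoop {M : Type*} [TopologicalSpace M] [ChartedSpace (ℝ × ℝ) M] (α : Loop M) : Prop :=
  ContMDiff 𝓘(ℝ, ℝ) 𝓘(ℝ, ℝ × ℝ) ∞ (fun u : ℝ => α (u : UnitAddCircle))

/-- The velocity vector of the loop `α` at the parameter `s`, an element of the tangent space of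
`M` at `α s` (which in Mathlib is `ℝ × ℝ`, through the preferred chart at `α s`). -/
def velocity {M : Type*} [TopologicalSpace M] [ChartedSpace (ℝ × ℝ) M] (α : Loop M)
    (s : UnitAddCircle) : ℝ × ℝ :=
  mfderiv 𝓘(ℝ, ℝ) 𝓘(ℝ, ℝ × ℝ) (fun u : ℝ => α (s + (u : UnitAddCircle))) 0 (1 : ℝ)

/-- The determinant of the pair of velocity vectors of `α` at `s` and of `β` at `t`, where
`α s = β t`, in the preferred chart at that point. It is nonzero iff the two vectors span the
tangent space, and its sign tells whether they match the orientation of the surface. -/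
def crossing {M : Type*} [TopologicalSpace M] [ChartedSpace (ℝ × ℝ) M] (α β : Loop M)
    (s t : UnitAddCircle) : ℝ :=
  (velocity α s).1 * (velocity β t).2 - (velocity α s).2 * (velocity β t).1

/-- The intersections of two loops, as pairs of parameters. -/
def intersections {M : Type*} [TopologicalSpace M] (α β : Loop M) :
    Set (UnitAddCircle × UnitAddCircle) :=
  {p | α p.1 = β p.2}

/-- Two loops are transverse if they are smooth and their velocity vectors span the tangent
space at every intersection. -/
structure AreTransverse {M : Type*} [TopologicalSpace M] [ChartedSpace (ℝ × ℝ) M]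
    (α β : Loop M) : Prop where
  smooth_left : IsSmoothLoop α
  smooth_right : IsSmoothLoop β
  crossing_ne_zero : ∀ p ∈ intersections α β, crossing α β p.1 p.2 ≠ 0

/-! ### The Goldman bracket -/

/-- The signed sum `∑ₚ ε(p) [α *ₚ β]` over the intersections of `α` and `β`, in the free module
on the set of free homotopy classes of loops. -/
def intersectionSum (R : Type*) [CommRing R] {M : Type*} [TopologicalSpace M]
    [ChartedSpace (ℝ × ℝ) M] [OrientedSurface M] (α β : Loop M) : FreeLoopClass M →₀ R :=
  ∑ᶠ p : intersections α β,
    Finsupp.single (freeClass (loopProduct α β p.1.1 p.1.2 p.2))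
      (((SignType.sign (crossing α β p.1.1 p.1.2) : SignType) : ℤ) : R)

open Classical in
/-- The Goldman bracket of two free homotopy classes of loops: the signed sum over the
intersections of two transverse representatives. -/
def bracketOfClasses (R : Type*) [CommRing R] {M : Type*} [TopologicalSpace M]
    [ChartedSpace (ℝ × ℝ) M] [OrientedSurface M] (x y : FreeLoopClass M) :
    FreeLoopClass M →₀ R :=
  if h : ∃ q : Loop M × Loop M, freeClass q.1 = x ∧ freeClass q.2 = y ∧ AreTransverse q.1 q.2
  then intersectionSum R h.choose.1 h.choose.2
  else 0

/-- The Goldman bracket, extended bilinearly to the free `R`-module on the set of free homotopy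
classes of loops. -/
def bracket (R : Type*) [CommRing R] (M : Type*) [TopologicalSpace M]
    [ChartedSpace (ℝ × ℝ) M] [OrientedSurface M] :
    (FreeLoopClass M →₀ R) →ₗ[R] (FreeLoopClass M →₀ R) →ₗ[R] (FreeLoopClass M →₀ R) :=
  Finsupp.linearCombination R fun x =>
    Finsupp.linearCombination R fun y => bracketOfClasses R x y

/-! ### The torus -/

/-- The closed torus `ℝ / ℤ × ℝ / ℤ`. -/
abbrev Torus := UnitAddCircle × UnitAddCircle

/-- The chart of the circle that inverts the projection `ℝ → ℝ / ℤ` on `(a, a + 1)`. -/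
def circleChart (a : ℝ) : OpenPartialHomeomorph UnitAddCircle ℝ :=
  (AddCircle.openPartialHomeomorphCoe (1 : ℝ) a).symm

/-- The chart of the torus that inverts the projection `ℝ × ℝ → ℝ / ℤ × ℝ / ℤ` on
`(a.1, a.1 + 1) × (a.2, a.2 + 1)`. -/
def torusChart (a : ℝ × ℝ) : OpenPartialHomeomorph Torus (ℝ × ℝ) :=
  (circleChart a.1).prod (circleChart a.2)

/-- A real number `a` for which the point `c` lies in the domain of `circleChart a`. -/
def circleBase (c : UnitAddCircle) : ℝ := (AddCircle.equivIco 1 0 c : ℝ) - 1 / 2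

theorem mem_circleChart_source (c : UnitAddCircle) : c ∈ (circleChart (circleBase c)).source := by
  have h : (AddCircle.equivIco 1 0 c : ℝ) ∈
      (AddCircle.openPartialHomeomorphCoe (1 : ℝ) (circleBase c)).source := by
    simp only [AddCircle.openPartialHomeomorphCoe_source, circleBase, Set.mem_Ioo]
    constructor <;> linarith
  have h2 := (AddCircle.openPartialHomeomorphCoe (1 : ℝ) (circleBase c)).map_source h
  simpa [circleChart] using h2

instance : ChartedSpace (ℝ × ℝ) Torus where
  atlas := Set.range torusChart
  chartAt p := torusChart (circleBase p.1, circleBase p.2)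
  mem_chart_source p := ⟨mem_circleChart_source p.1, mem_circleChart_source p.2⟩
  chart_mem_atlas _ := Set.mem_range_self _

theorem circleChart_transition (a a' x : ℝ)
    (hx : (x : UnitAddCircle) ∈ (circleChart a').source) :
    ∃ c : ℝ, ∀ᶠ y in nhds x, circleChart a' ((circleChart a).symm y) = y + c := by
  set e := AddCircle.openPartialHomeomorphCoe (1 : ℝ) a'
  have hz : e.symm (x : UnitAddCircle) ∈ e.source := e.map_target hx
  have hzx : ((e.symm (x : UnitAddCircle) : ℝ) : UnitAddCircle) = x := e.right_inv hx
  have h0 : ((e.symm (x : UnitAddCircle) - x : ℝ) : UnitAddCircle) = 0 := by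
    rw [AddCircle.coe_sub, hzx, sub_self]
  refine ⟨e.symm (x : UnitAddCircle) - x, ?_⟩
  have hc : ContinuousAt (fun y : ℝ => y + (e.symm (x : UnitAddCircle) - x)) x := by fun_prop
  have hmem : ∀ᶠ y in nhds x, y + (e.symm (x : UnitAddCircle) - x) ∈ e.source :=
    hc.eventually_mem (e.open_source.mem_nhds (by simpa using hz))
  filter_upwards [hmem] with y hy
  have h1 : ((y + (e.symm (x : UnitAddCircle) - x) : ℝ) : UnitAddCircle) = y := by
    rw [AddCircle.coe_add, h0, add_zero]
  change e.symm (y : UnitAddCircle) = _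
  rw [← h1]
  exact e.left_inv hy

theorem torusChart_transition (a a' x : ℝ × ℝ)
    (hx : x ∈ ((torusChart a).symm.trans (torusChart a')).source) :
    ∃ c : ℝ × ℝ, (torusChart a).symm.trans (torusChart a') =ᶠ[nhds x] fun y => y + c := by
  have hx' := hx.2
  obtain ⟨c, hc⟩ := circleChart_transition a.1 a'.1 x.1 hx'.1
  obtain ⟨d, hd⟩ := circleChart_transition a.2 a'.2 x.2 hx'.2
  refine ⟨(c, d), ?_⟩
  filter_upwards [hc.prod_nhds hd] with y hy
  exact Prod.ext hy.1 hy.2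

instance : OrientedSurface Torus where
  toIsManifold := by
    apply isManifold_of_contDiffOn
    rintro _ _ ⟨a, rfl⟩ ⟨a', rfl⟩
    simp only [modelWithCornersSelf_coe, modelWithCornersSelf_coe_symm, Function.comp_id,
      Function.id_comp, Set.preimage_id, Set.range_id, Set.inter_univ]
    intro x hx
    obtain ⟨c, hc⟩ := torusChart_transition a a' x hx
    exact ((contDiff_id.add contDiff_const).contDiffAt.congr_of_eventuallyEq hc).contDiffWithinAt
  jacobian_pos := by
    rintro _ ⟨a, rfl⟩ _ ⟨a', rfl⟩ x hx
    obtain ⟨c, hc⟩ := torusChart_transition a a' x hx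
    rw [hc.fderiv_eq, fderiv_add_const, fderiv_fun_id]
    simp [ContinuousLinearMap.det]

/-- The class `a` in the fundamental group of the torus: the first coordinate circle. -/
def a : FundamentalGroup Torus 0 :=
  FundamentalGroup.fromPath (Path.Homotopic.Quotient.mk
    { toFun := fun t => (((t : ℝ) : UnitAddCircle), 0)
      continuous_toFun :=
        ((AddCircle.continuous_mk' 1).comp continuous_subtype_val).prodMk continuous_const
      source' := by simp
      target' := by simp })

/-- The class `b` in the fundamental group of the torus: the second coordinate circle. -/
def b : FundamentalGroup Torus 0 :=
  FundamentalGroup.fromPath (Path.Homotopic.Quotient.mk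
    { toFun := fun t => (0, ((t : ℝ) : UnitAddCircle))
      continuous_toFun :=
        continuous_const.prodMk ((AddCircle.continuous_mk' 1).comp continuous_subtype_val)
      source' := by simp
      target' := by simp })

/-- The free homotopy class of loops on the torus represented by the word `a ^ i * b ^ j`. -/
def word (i j : ℤ) : FreeLoopClass Torus := freeClassOfPi1 (a ^ i * b ^ j)

end Goldman

end

/-! A loop on the torus lifts to a plane curve whose endpoints differ by a lattice vector, its
degree. Homotopies lift too, and two lifts with equal degree are joined by a straight-line homotopy,
so the degree classifies free homotopy classes (`freeClass_eq_iff`). It is additive under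
concatenation (`loopDegree_loopProduct`). Hence all terms of the bracket of classes of degrees d and
e lie on the single basis element of degree d + e, and only the signed number of intersections
remains to be found.

With lifts f and g, intersections are the zeros on the torus of F(s, t) = f(s) - g(t). The integral
of ψ(F) times the Jacobian of F over a unit square is the determinant of the two degrees times the
integral of ψ (`integral_torusMk_mul_jacobian`). For a character ψ the integral splits into
one-variable integrals; density of trigonometric polynomials gives every continuous ψ. A bump ψ
concentrated at 0 localises the integral at the zeros of F, and the change of variables formula
makes each zero contribute its sign (`sum_sign_jacobian`). Straight lines, suitably translated,
provide transverse representatives. -/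

namespace Goldman

/-! ### Lifts of loops on the torus and their degree -/

/-- The projection `ℝ × ℝ → ℝ / ℤ × ℝ / ℤ`. -/
def torusMk (x : ℝ × ℝ) : Torus := ((x.1 : UnitAddCircle), (x.2 : UnitAddCircle))

/-- The inclusion of the lattice `ℤ × ℤ` in the plane. -/
def latticePoint (d : ℤ × ℤ) : ℝ × ℝ := ((d.1 : ℝ), (d.2 : ℝ))

theorem continuous_torusMk : Continuous torusMk :=
  ((AddCircle.continuous_mk' 1).comp continuous_fst).prodMk
    ((AddCircle.continuous_mk' 1).comp continuous_snd)

theorem torusMk_add (x y : ℝ × ℝ) : torusMk (x + y) = torusMk x + torusMk y := rfl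

theorem torusMk_sub (x y : ℝ × ℝ) : torusMk (x - y) = torusMk x - torusMk y := rfl

theorem latticePoint_add (d e : ℤ × ℤ) :
    latticePoint (d + e) = latticePoint d + latticePoint e := by
  simp [latticePoint]

theorem latticePoint_injective : Function.Injective latticePoint := by
  intro d e h
  simpa [latticePoint, Prod.ext_iff] using h

theorem coe_eq_zero_iff_int (x : ℝ) : (x : UnitAddCircle) = 0 ↔ ∃ n : ℤ, x = n := by
  rw [AddCircle.coe_eq_zero_iff]
  simp [eq_comm]

theorem torusMk_eq_zero_iff (x : ℝ × ℝ) : torusMk x = 0 ↔ ∃ d, x = latticePoint d := by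
  simp only [torusMk, Prod.ext_iff, Prod.fst_zero, Prod.snd_zero, coe_eq_zero_iff_int,
    latticePoint]
  constructor
  · rintro ⟨⟨m, hm⟩, n, hn⟩
    exact ⟨(m, n), hm, hn⟩
  · rintro ⟨d, h1, h2⟩
    exact ⟨⟨d.1, h1⟩, d.2, h2⟩

@[simp] theorem torusMk_latticePoint (d : ℤ × ℤ) : torusMk (latticePoint d) = 0 :=
  (torusMk_eq_zero_iff _).2 ⟨d, rfl⟩

theorem torusMk_eq_iff (x y : ℝ × ℝ) : torusMk x = torusMk y ↔ ∃ d, x = y + latticePoint d := by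
  rw [← sub_eq_zero, ← torusMk_sub, torusMk_eq_zero_iff]
  simp only [sub_eq_iff_eq_add']

/-- Uniqueness of lifts: the difference is continuous with values in the discrete lattice, hence
constant on a preconnected set. -/
theorem exists_const_of_torusMk_eq {X : Type*} [TopologicalSpace X] {S : Set X}
    (hS : IsPreconnected S) {F G : X → ℝ × ℝ} (hF : ContinuousOn F S) (hG : ContinuousOn G S)
    (h : ∀ x ∈ S, torusMk (F x) = torusMk (G x)) :
    ∃ d, ∀ x ∈ S, F x = G x + latticePoint d := by
  have key : ∀ φ : X → ℝ, ContinuousOn φ S → (∀ x ∈ S, ∃ n : ℤ, φ x = n) →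
      ∃ n : ℤ, ∀ x ∈ S, φ x = n := by
    intro φ hφ hn
    have : DiscreteTopology (Set.range ((↑) : ℤ → ℝ)) :=
      Int.isClosedEmbedding_coe_real.isEmbedding.toHomeomorph.symm.isEmbedding.discreteTopology
    obtain ⟨_, ⟨n, rfl⟩, hy⟩ := hS.eqOn_const_of_mapsTo (T := Set.range ((↑) : ℤ → ℝ)) ⟨this⟩ hφ
      (fun x hx => let ⟨n, h⟩ := hn x hx; ⟨n, h.symm⟩) (Set.range_nonempty _)
    exact ⟨n, hy⟩
  have h' : ∀ x ∈ S, ∃ d, F x - G x = latticePoint d := fun x hx =>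
    (torusMk_eq_zero_iff _).1 (by rw [torusMk_sub, h x hx, sub_self])
  obtain ⟨m, hm⟩ := key (fun x => (F x - G x).1) (hF.sub hG).fst
    fun x hx => let ⟨d, hd⟩ := h' x hx; ⟨d.1, by simp only [hd]; rfl⟩
  obtain ⟨n, hn⟩ := key (fun x => (F x - G x).2) (hF.sub hG).snd
    fun x hx => let ⟨d, hd⟩ := h' x hx; ⟨d.2, by simp only [hd]; rfl⟩
  exact ⟨(m, n), fun x hx => (sub_eq_iff_eq_add'.1 (Prod.ext (hm x hx) (hn x hx)))⟩

theorem exists_lift_circle {X : Type*} [TopologicalSpace X] [SimplyConnectedSpace X]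
    [LocallyPathConnectedSpace X] (φ : C(X, UnitAddCircle)) :
    ∃ F : X → ℝ, Continuous F ∧ ∀ x, (F x : UnitAddCircle) = φ x := by
  obtain ⟨x₀⟩ : Nonempty X := inferInstance
  obtain ⟨r, hr⟩ := QuotientAddGroup.mk_surjective (φ x₀)
  obtain ⟨F, ⟨-, hF⟩, -⟩ :=
    (AddCircle.isCoveringMap_coe (1 : ℝ)).existsUnique_continuousMap_lifts φ x₀ r hr
  exact ⟨F, F.continuous, fun x => congrFun hF x⟩

theorem exists_lift_torus {X : Type*} [TopologicalSpace X] [SimplyConnectedSpace X]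
    [LocallyPathConnectedSpace X] (φ : C(X, Torus)) :
    ∃ F : X → ℝ × ℝ, Continuous F ∧ ∀ x, torusMk (F x) = φ x := by
  obtain ⟨F, hF, hF'⟩ := exists_lift_circle (ContinuousMap.fst.comp φ)
  obtain ⟨G, hG, hG'⟩ := exists_lift_circle (ContinuousMap.snd.comp φ)
  exact ⟨fun x => (F x, G x), hF.prodMk hG, fun x => Prod.ext (hF' x) (hG' x)⟩

/-- `f` is a lift to the plane of the loop `α`, whose endpoints differ by the lattice
point `d`. -/
structure IsLift (α : Loop Torus) (f : ℝ → ℝ × ℝ) (d : ℤ × ℤ) : Prop where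
  continuous : Continuous f
  mk_apply : ∀ u : ℝ, torusMk (f u) = α (u : UnitAddCircle)
  add_one : ∀ u : ℝ, f (u + 1) = f u + latticePoint d

theorem exists_isLift (α : Loop Torus) : ∃ f d, IsLift α f d := by
  obtain ⟨f, hf, hf'⟩ := exists_lift_torus (α.comp ⟨_, AddCircle.continuous_mk' (1 : ℝ)⟩)
  obtain ⟨d, hd⟩ := exists_const_of_torusMk_eq (isPreconnected_univ (α := ℝ))
    (F := fun u => f (u + 1)) (G := f) (by fun_prop) (by fun_prop) (fun u _ => by
      rw [hf', hf']
      exact congrArg α (AddCircle.coe_add_period 1 u))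
  exact ⟨f, d, hf, hf', fun u => hd u trivial⟩

/-- The degree can be read off from any lift over `[0, 1]` alone, since such a lift is a lattice
translate of `f` there. -/
theorem IsLift.eq_sub_of_path {α : Loop Torus} {f : ℝ → ℝ × ℝ} {d : ℤ × ℤ} (hf : IsLift α f d)
    {h : ℝ → ℝ × ℝ} (hc : ContinuousOn h (Set.Icc 0 1))
    (hh : ∀ t ∈ Set.Icc (0 : ℝ) 1, torusMk (h t) = α (t : UnitAddCircle)) :
    h 1 = h 0 + latticePoint d := by
  obtain ⟨e, he⟩ := exists_const_of_torusMk_eq (isPreconnected_Icc (a := (0 : ℝ)) (b := 1))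
    hc hf.continuous.continuousOn (fun t ht => (hh t ht).trans (hf.mk_apply t).symm)
  have h1 := hf.add_one 0
  rw [zero_add] at h1
  rw [he 1 (by simp), he 0 (by simp), h1]
  abel

theorem IsLift.degree_eq_of_homotopic {α β : Loop Torus} (H : α.Homotopic β)
    {f g : ℝ → ℝ × ℝ} {d e : ℤ × ℤ} (hf : IsLift α f d) (hg : IsLift β g e) : d = e := by
  obtain ⟨H⟩ := H
  -- Clamping the homotopy parameter to `[0, 1]` extends the homotopy to the simply connected plane,
  -- where it lifts. The displacement of the lift over a period is then constant in that parameter.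
  let φ : C(ℝ × ℝ, Torus) :=
    ⟨fun x => H (Set.projIcc 0 1 zero_le_one x.1, (x.2 : UnitAddCircle)),
      H.continuous.comp ((continuous_projIcc.comp continuous_fst).prodMk
        ((AddCircle.continuous_mk' 1).comp continuous_snd))⟩
  obtain ⟨F, hF, hF'⟩ := exists_lift_torus φ
  obtain ⟨c, hc⟩ := exists_const_of_torusMk_eq (isPreconnected_univ (α := ℝ))
    (F := fun r => F (r, 1)) (G := fun r => F (r, 0)) (by fun_prop) (by fun_prop) (fun r _ => by
      rw [hF', hF']
      have h := AddCircle.coe_period (1 : ℝ)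
      simp [φ, h])
  have h0 := hf.eq_sub_of_path (h := fun t => F (0, t)) (by fun_prop) (fun t _ => by
    rw [hF']; simp [φ])
  have h1 := hg.eq_sub_of_path (h := fun t => F (1, t)) (by fun_prop) (fun t _ => by
    rw [hF']; simp [φ])
  rw [hc 0 trivial, add_right_inj] at h0
  rw [hc 1 trivial, add_right_inj] at h1
  exact (latticePoint_injective h0).symm.trans (latticePoint_injective h1)

/-- Equal degrees make `g - f` periodic, so the straight-line homotopy between the lifts descends to
the torus. -/
theorem IsLift.homotopic {α β : Loop Torus} {f g : ℝ → ℝ × ℝ} {d : ℤ × ℤ}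
    (hf : IsLift α f d) (hg : IsLift β g d) : α.Homotopic β := by
  have hper : Function.Periodic (fun u => g u - f u) (1 : ℝ) := fun u => by
    simp only [hf.add_one, hg.add_one]
    abel
  have hcont : Continuous (hper.lift : UnitAddCircle → ℝ × ℝ) :=
    continuous_coinduced_dom.2 (hg.continuous.sub hf.continuous)
  refine ⟨{ toFun := fun p => α p.2 + torusMk ((p.1 : ℝ) • hper.lift p.2)
            continuous_toFun := ?_
            map_zero_left := fun c => ?_
            map_one_left := fun c => ?_ }⟩
  · exact (α.continuous.comp continuous_snd).add (continuous_torusMk.comp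
      ((continuous_subtype_val.comp continuous_fst).smul (hcont.comp continuous_snd)))
  · have h : torusMk 0 = 0 := rfl
    simp [h]
  · obtain ⟨u, rfl⟩ := QuotientAddGroup.mk_surjective c
    change α (u : UnitAddCircle) + torusMk ((1 : ℝ) • (g u - f u)) = β (u : UnitAddCircle)
    rw [one_smul, torusMk_sub, hf.mk_apply, hg.mk_apply, add_sub_cancel]

/-- The degree of a loop on the torus. -/
noncomputable def loopDegree (α : Loop Torus) : ℤ × ℤ := (exists_isLift α).choose_spec.choose

theorem exists_isLift_loopDegree (α : Loop Torus) : ∃ f, IsLift α f (loopDegree α) :=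
  ⟨_, (exists_isLift α).choose_spec.choose_spec⟩

theorem IsLift.loopDegree_eq {α : Loop Torus} {f : ℝ → ℝ × ℝ} {d : ℤ × ℤ} (hf : IsLift α f d) :
    loopDegree α = d :=
  let ⟨_, hg⟩ := exists_isLift_loopDegree α
  hg.degree_eq_of_homotopic (.refl α) hf

theorem freeClass_eq_iff (α β : Loop Torus) :
    freeClass α = freeClass β ↔ loopDegree α = loopDegree β := by
  obtain ⟨f, hf⟩ := exists_isLift_loopDegree α
  obtain ⟨g, hg⟩ := exists_isLift_loopDegree β
  constructor
  · intro h
    exact hf.degree_eq_of_homotopic (Quotient.exact h) hg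
  · intro h
    exact Quotient.sound (hf.homotopic (h ▸ hg))

/-! ### Degrees of closed paths and of concatenations -/

/-- A lift `h` of the closed path `γ`, defined on `[0, 1]`, whose endpoints differ by `d`. -/
structure IsPathLift {x : Torus} (γ : Path x x) (h : ℝ → ℝ × ℝ) (d : ℤ × ℤ) : Prop where
  continuousOn : ContinuousOn h (Set.Icc 0 1)
  mk_apply : ∀ t : unitInterval, torusMk (h t) = γ t
  map_one : h 1 = h 0 + latticePoint d

theorem closeUp_coe_unitInterval {X : Type*} [TopologicalSpace X] {x : X} (γ : Path x x)
    (t : unitInterval) : closeUp γ ((t : ℝ) : UnitAddCircle) = γ t := by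
  rcases t.2.2.lt_or_eq with h | h
  · exact closeUp_coe γ ⟨t.2.1, h⟩
  · obtain rfl : t = 1 := Subtype.ext h
    have h0 := closeUp_coe γ (t := 0) (by simp)
    have h1 := AddCircle.coe_period (1 : ℝ)
    rw [γ.target]
    simp only [Set.Icc.coe_one, h1]
    exact h0.trans γ.source

theorem IsPathLift.loopDegree_closeUp {x : Torus} {γ : Path x x} {h : ℝ → ℝ × ℝ} {d : ℤ × ℤ}
    (hh : IsPathLift γ h d) : loopDegree (closeUp γ) = d := by
  obtain ⟨f, hf⟩ := exists_isLift_loopDegree (closeUp γ)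
  have h1 := hf.eq_sub_of_path hh.continuousOn
    (fun t ht => (hh.mk_apply ⟨t, ht⟩).trans (closeUp_coe_unitInterval γ ⟨t, ht⟩).symm)
  rw [hh.map_one, add_right_inj] at h1
  exact (latticePoint_injective h1).symm

theorem exists_isPathLift {x : Torus} (γ : Path x x) :
    ∃ h, IsPathLift γ h (loopDegree (closeUp γ)) := by
  obtain ⟨f, hf⟩ := exists_isLift_loopDegree (closeUp γ)
  refine ⟨f, hf.continuous.continuousOn, fun t => ?_, by simpa using hf.add_one 0⟩
  rw [hf.mk_apply, closeUp_coe_unitInterval]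

/-- The second lift is translated by the lattice vector `c` so that it starts where the first ends;
this changes neither its projection nor its displacement. -/
theorem IsPathLift.trans {x : Torus} {γ γ' : Path x x} {h h' : ℝ → ℝ × ℝ} {d d' : ℤ × ℤ}
    (hh : IsPathLift γ h d) (hh' : IsPathLift γ' h' d') :
    ∃ k, IsPathLift (γ.trans γ') k (d + d') := by
  have h0 : torusMk (h' 0) = torusMk (h 1) := by
    have e1 := hh.mk_apply 1
    have e2 := hh'.mk_apply 0
    simp only [Set.Icc.coe_one, Set.Icc.coe_zero, Path.source, Path.target] at e1 e2
    rw [e1, e2]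
  obtain ⟨c, hc⟩ := (torusMk_eq_iff _ _).1 h0
  refine ⟨fun t => if t ≤ 1 / 2 then h (2 * t) else h' (2 * t - 1) - latticePoint c, ?_, ?_, ?_⟩
  · refine ContinuousOn.if (p := fun t : ℝ => t ≤ 1 / 2) ?_ ?_ ?_
    · rintro t ⟨-, ht⟩
      have : t = 1 / 2 := by
        have := frontier_Iic_subset (1 / 2 : ℝ) ht
        simpa using this
      subst this
      norm_num [hc]
    · have : closure {t : ℝ | t ≤ 1 / 2} = Set.Iic (1 / 2) := isClosed_Iic.closure_eq
      rw [this]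
      refine hh.continuousOn.comp (by fun_prop) ?_
      rintro t ⟨⟨h1, h2⟩, h3⟩
      simp only [Set.mem_Iic] at h3
      constructor <;> linarith
    · have : closure {t : ℝ | ¬ t ≤ 1 / 2} ⊆ Set.Ici (1 / 2) :=
        closure_minimal (fun t ht => (not_le.1 ht).le) isClosed_Ici
      refine ContinuousOn.sub (hh'.continuousOn.comp (by fun_prop) ?_) continuousOn_const
      rintro t ⟨⟨h1, h2⟩, h3⟩
      have h3 := this h3
      simp only [Set.mem_Ici] at h3
      constructor <;> linarith
  · intro t
    rw [Path.trans_apply]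
    split_ifs with ht
    · exact hh.mk_apply ⟨2 * t, _⟩
    · rw [torusMk_sub, torusMk_latticePoint, sub_zero]
      exact hh'.mk_apply ⟨2 * t - 1, _⟩
  · have h1 : ¬ (1 : ℝ) ≤ 1 / 2 := by norm_num
    have h2 : (0 : ℝ) ≤ 1 / 2 := by norm_num
    have h3 : (2 * 1 - 1 : ℝ) = 1 := by norm_num
    simp only [h1, h2, if_true, if_false, h3, mul_zero]
    rw [hh'.map_one, hc, hh.map_one, latticePoint_add]
    abel

theorem loopDegree_closeUp_trans {x : Torus} (γ γ' : Path x x) :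
    loopDegree (closeUp (γ.trans γ')) = loopDegree (closeUp γ) + loopDegree (closeUp γ') := by
  obtain ⟨h, hh⟩ := exists_isPathLift γ
  obtain ⟨h', hh'⟩ := exists_isPathLift γ'
  obtain ⟨k, hk⟩ := hh.trans hh'
  exact hk.loopDegree_closeUp

theorem loopDegree_closeUp_loopFrom (α : Loop Torus) (s : UnitAddCircle) :
    loopDegree (closeUp (loopFrom α s)) = loopDegree α := by
  obtain ⟨f, hf⟩ := exists_isLift_loopDegree α
  obtain ⟨u, rfl⟩ := QuotientAddGroup.mk_surjective s
  refine IsPathLift.loopDegree_closeUp (h := fun t => f (u + t))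
    ⟨(hf.continuous.comp (continuous_const.add continuous_id)).continuousOn, fun t => ?_, ?_⟩
  · exact hf.mk_apply _
  · simpa using hf.add_one u

theorem closeUp_cast {X : Type*} [TopologicalSpace X] {x y : X} (γ : Path x x) (h : y = x) :
    closeUp (γ.cast h h) = closeUp γ := by
  subst h
  rfl

theorem loopDegree_loopProduct (α β : Loop Torus) (s t : UnitAddCircle) (h : α s = β t) :
    loopDegree (loopProduct α β s t h) = loopDegree α + loopDegree β := by
  rw [loopProduct, loopDegree_closeUp_trans, closeUp_cast, loopDegree_closeUp_loopFrom,
    loopDegree_closeUp_loopFrom]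

/-! ### The degree on free homotopy classes and on the fundamental group -/

/-- The degree of a free homotopy class of loops on the torus. -/
noncomputable def classDegree (x : FreeLoopClass Torus) : ℤ × ℤ :=
  Quotient.lift loopDegree (fun α β h => (freeClass_eq_iff α β).1 (Quotient.sound h)) x

@[simp] theorem classDegree_freeClass (α : Loop Torus) :
    classDegree (freeClass α) = loopDegree α := rfl

theorem classDegree_injective : Function.Injective classDegree := by
  rintro ⟨α⟩ ⟨β⟩ h
  exact (freeClass_eq_iff α β).2 h

theorem classDegree_freeClassOfPi1_mul (p q : FundamentalGroup Torus 0) :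
    classDegree (freeClassOfPi1 (p * q)) =
      classDegree (freeClassOfPi1 p) + classDegree (freeClassOfPi1 q) := by
  obtain ⟨γ, rfl⟩ : ∃ γ : Path (0 : Torus) 0,
      FundamentalGroup.fromPath (Path.Homotopic.Quotient.mk γ) = p := Quotient.exists_rep p
  obtain ⟨γ', rfl⟩ : ∃ γ : Path (0 : Torus) 0,
      FundamentalGroup.fromPath (Path.Homotopic.Quotient.mk γ) = q := Quotient.exists_rep q
  -- The product `p * q` unfolds to the concatenation in the reverse order, which is harmless
  -- because the lattice is commutative.
  exact (loopDegree_closeUp_trans γ' γ).trans (add_comm _ _)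

/-- The degree as a homomorphism on the fundamental group. -/
noncomputable def pi1Degree : FundamentalGroup Torus 0 →* Multiplicative (ℤ × ℤ) :=
  MonoidHom.mk' (fun p => Multiplicative.ofAdd (classDegree (freeClassOfPi1 p)))
    classDegree_freeClassOfPi1_mul

theorem pi1Degree_a : pi1Degree a = Multiplicative.ofAdd (1, 0) := by
  refine congrArg Multiplicative.ofAdd
    (IsPathLift.loopDegree_closeUp (h := fun t => (t, 0)) ⟨by fun_prop, fun t => rfl, ?_⟩)
  simp [latticePoint]

theorem pi1Degree_b : pi1Degree b = Multiplicative.ofAdd (0, 1) := by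
  refine congrArg Multiplicative.ofAdd
    (IsPathLift.loopDegree_closeUp (h := fun t => (0, t)) ⟨by fun_prop, fun t => rfl, ?_⟩)
  simp [latticePoint]

@[simp] theorem classDegree_word (i j : ℤ) : classDegree (word i j) = (i, j) := by
  have h : pi1Degree (a ^ i * b ^ j) = Multiplicative.ofAdd (i, j) := by
    rw [map_mul, map_zpow, map_zpow, pi1Degree_a, pi1Degree_b, ← ofAdd_zsmul, ← ofAdd_zsmul,
      ← ofAdd_add]
    simp
  exact Multiplicative.ofAdd.injective h

theorem word_bijective : Function.Bijective (fun p : ℤ × ℤ => word p.1 p.2) :=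
  ⟨fun p q h => by simpa using congrArg classDegree h,
    fun x => ⟨classDegree x, classDegree_injective (by simp)⟩⟩

end Goldman

namespace Goldman

open MeasureTheory

/-! ### Integrals of functions on the torus along sums of two periodic curves -/

/-- The character `x ↦ exp (2 π i (m₀ x₁ + m₁ x₂))` of the plane. -/
noncomputable def planeChar (m : Fin 2 → ℤ) (x : ℝ × ℝ) : ℂ :=
  Complex.exp (2 * Real.pi * Complex.I * (m 0 * x.1 + m 1 * x.2))

theorem continuous_planeChar (m : Fin 2 → ℤ) : Continuous (planeChar m) := by
  unfold planeChar
  fun_prop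

theorem planeChar_add (m : Fin 2 → ℤ) (x y : ℝ × ℝ) :
    planeChar m (x + y) = planeChar m x * planeChar m y := by
  rw [planeChar, planeChar, planeChar, ← Complex.exp_add]
  congr 1
  simp only [Prod.fst_add, Prod.snd_add, Complex.ofReal_add]
  ring

@[simp] theorem planeChar_latticePoint (m : Fin 2 → ℤ) (d : ℤ × ℤ) :
    planeChar m (latticePoint d) = 1 := by
  rw [planeChar, Complex.exp_eq_one_iff]
  refine ⟨m 0 * d.1 + m 1 * d.2, ?_⟩
  simp only [latticePoint]
  push_cast
  ring

theorem mFourier_eq_planeChar (m : Fin 2 → ℤ) (x : ℝ × ℝ) :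
    UnitAddTorus.mFourier m ![(x.1 : UnitAddCircle), (x.2 : UnitAddCircle)] = planeChar m x := by
  simp only [UnitAddTorus.mFourier, ContinuousMap.coe_mk, Fin.prod_univ_two, Matrix.cons_val_zero,
    Matrix.cons_val_one, fourier_coe_apply, planeChar]
  rw [← Complex.exp_add]
  congr 1
  push_cast
  ring

/-- A continuously differentiable curve `f` in the plane with derivative `f'`, which is periodic
up to translation by the lattice point `d`. -/
structure IsQuasiPeriodic (f f' : ℝ → ℝ × ℝ) (d : ℤ × ℤ) : Prop where
  hasDerivAt : ∀ u, HasDerivAt f (f' u) u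
  continuous_deriv : Continuous f'
  add_one : ∀ u, f (u + 1) = f u + latticePoint d

namespace IsQuasiPeriodic

variable {f f' h h' : ℝ → ℝ × ℝ} {d e : ℤ × ℤ}

theorem continuous (hf : IsQuasiPeriodic f f' d) : Continuous f :=
  continuous_iff_continuousAt.2 fun u => (hf.hasDerivAt u).continuousAt

theorem hasDerivAt_fst (hf : IsQuasiPeriodic f f' d) (u : ℝ) :
    HasDerivAt (fun u => (f u).1) (f' u).1 u := by
  simpa using ((hf.hasDerivAt u).hasFDerivAt.fst).hasDerivAt

theorem hasDerivAt_snd (hf : IsQuasiPeriodic f f' d) (u : ℝ) :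
    HasDerivAt (fun u => (f u).2) (f' u).2 u := by
  simpa using ((hf.hasDerivAt u).hasFDerivAt.snd).hasDerivAt

/-- Up to the factor 2πi the integrand is the derivative of `planeChar m ∘ f`, which is 1-periodic
because characters are trivial on the lattice. -/
theorem integral_planeChar (hf : IsQuasiPeriodic f f' d) (m : Fin 2 → ℤ) (c : ℝ) :
    (m 0 : ℂ) * (∫ u in c..(c + 1), planeChar m (f u) * (f' u).1) +
      m 1 * (∫ u in c..(c + 1), planeChar m (f u) * (f' u).2) = 0 := by
  have hc := continuous_planeChar m
  have hcf := hf.continuous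
  have hc' := hf.continuous_deriv
  have hderiv : ∀ u, HasDerivAt (fun u => planeChar m (f u)) (2 * Real.pi * Complex.I *
      ((m 0 : ℂ) * (planeChar m (f u) * (f' u).1) + m 1 * (planeChar m (f u) * (f' u).2))) u := by
    intro u
    have h1 : HasDerivAt (fun u => ((f u).1 : ℂ)) ((f' u).1 : ℂ) u :=
      (hf.hasDerivAt_fst u).ofReal_comp
    have h2 : HasDerivAt (fun u => ((f u).2 : ℂ)) ((f' u).2 : ℂ) u :=
      (hf.hasDerivAt_snd u).ofReal_comp
    convert! (((h1.const_mul (m 0 : ℂ)).add (h2.const_mul (m 1 : ℂ))).const_mul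
      (2 * Real.pi * Complex.I)).cexp using 1
    simp only [planeChar, Pi.add_apply]
    ring
  have key := intervalIntegral.integral_eq_sub_of_hasDerivAt (a := c) (b := c + 1)
    (fun u _ => hderiv u) (Continuous.intervalIntegrable (by fun_prop) _ _)
  rw [hf.add_one, planeChar_add, planeChar_latticePoint, mul_one, sub_self,
    intervalIntegral.integral_const_mul, intervalIntegral.integral_add
      (Continuous.intervalIntegrable (by fun_prop) _ _)
      (Continuous.intervalIntegrable (by fun_prop) _ _),
    intervalIntegral.integral_const_mul, intervalIntegral.integral_const_mul] at key
  exact (mul_eq_zero.1 key).resolve_left Complex.two_pi_I_ne_zero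

theorem integral_deriv_fst (hf : IsQuasiPeriodic f f' d) (c : ℝ) :
    ∫ u in c..(c + 1), (f' u).1 = d.1 := by
  rw [intervalIntegral.integral_eq_sub_of_hasDerivAt (fun u _ => hf.hasDerivAt_fst u)
    (hf.continuous_deriv.fst.intervalIntegrable _ _), hf.add_one]
  simp [latticePoint]

theorem integral_deriv_snd (hf : IsQuasiPeriodic f f' d) (c : ℝ) :
    ∫ u in c..(c + 1), (f' u).2 = d.2 := by
  rw [intervalIntegral.integral_eq_sub_of_hasDerivAt (fun u _ => hf.hasDerivAt_snd u)
    (hf.continuous_deriv.snd.intervalIntegrable _ _), hf.add_one]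
  simp [latticePoint]

end IsQuasiPeriodic

/-- The closed unit square with lower left corner `c`. -/
def unitSquare (c : ℝ × ℝ) : Set (ℝ × ℝ) := Set.Icc c.1 (c.1 + 1) ×ˢ Set.Icc c.2 (c.2 + 1)

theorem isCompact_unitSquare (c : ℝ × ℝ) : IsCompact (unitSquare c) :=
  isCompact_Icc.prod isCompact_Icc

/-- The Jacobian determinant of `(s, t) ↦ f s + h t`, where `f'`, `h'` are the derivatives. -/
def jacobian (f' h' : ℝ → ℝ × ℝ) (p : ℝ × ℝ) : ℝ :=
  (f' p.1).1 * (h' p.2).2 - (f' p.1).2 * (h' p.2).1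

theorem continuous_jacobian {f' h' : ℝ → ℝ × ℝ} (hf : Continuous f') (hh : Continuous h') :
    Continuous (jacobian f' h') := by
  unfold jacobian
  fun_prop

theorem setIntegral_unitSquare_mul (u v : ℝ → ℂ) (c : ℝ × ℝ) :
    ∫ p in unitSquare c, u p.1 * v p.2 =
      (∫ s in c.1..(c.1 + 1), u s) * ∫ t in c.2..(c.2 + 1), v t := by
  rw [intervalIntegral.integral_of_le (by linarith), intervalIntegral.integral_of_le (by linarith),
    ← integral_Icc_eq_integral_Ioc, ← integral_Icc_eq_integral_Ioc]
  exact setIntegral_prod_mul u v _ _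

section

variable {f f' h h' : ℝ → ℝ × ℝ} {d e : ℤ × ℤ}

/-- The character of a sum factors and the Jacobian is a difference of two products, so the integral
is the determinant of two vectors of one-variable integrals. For `m = 0` these vectors are the
degrees. For `m ≠ 0` both are annihilated by the form `m`, hence are parallel. -/
theorem integral_planeChar_mul_jacobian (hf : IsQuasiPeriodic f f' d)
    (hh : IsQuasiPeriodic h h' e) (m : Fin 2 → ℤ) (c : ℝ × ℝ) :
    ∫ p in unitSquare c, planeChar m (f p.1 + h p.2) * jacobian f' h' p =
      if m = 0 then ((d.1 * e.2 - d.2 * e.1 : ℤ) : ℂ) else 0 := by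
  have hc := continuous_planeChar m
  have hcf := hf.continuous
  have hcf' := hf.continuous_deriv
  have hch := hh.continuous
  have hch' := hh.continuous_deriv
  have key : ∫ p in unitSquare c, planeChar m (f p.1 + h p.2) * jacobian f' h' p =
      (∫ u in c.1..(c.1 + 1), planeChar m (f u) * (f' u).1) *
        (∫ u in c.2..(c.2 + 1), planeChar m (h u) * (h' u).2) -
      (∫ u in c.1..(c.1 + 1), planeChar m (f u) * (f' u).2) *
        (∫ u in c.2..(c.2 + 1), planeChar m (h u) * (h' u).1) := by
    rw [← setIntegral_unitSquare_mul, ← setIntegral_unitSquare_mul, ← integral_sub]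
    · refine integral_congr_ae (Filter.Eventually.of_forall fun p => ?_)
      simp only [planeChar_add, jacobian]
      push_cast
      ring
    · exact (Continuous.continuousOn (by fun_prop)).integrableOn_compact (isCompact_unitSquare c)
    · exact (Continuous.continuousOn (by fun_prop)).integrableOn_compact (isCompact_unitSquare c)
  rw [key]
  split_ifs with hm
  · have h1 : ∀ x, planeChar m x = 1 := fun x => by simp [planeChar, hm]
    simp only [h1, one_mul, intervalIntegral.integral_ofReal, hf.integral_deriv_fst,
      hf.integral_deriv_snd, hh.integral_deriv_fst, hh.integral_deriv_snd]
    push_cast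
    ring
  · have e1 := hf.integral_planeChar m c.1
    have e2 := hh.integral_planeChar m c.2
    rcases eq_or_ne (m 0) 0 with h0 | h0
    · have h1 : (m 1 : ℂ) ≠ 0 := by
        intro h1
        apply hm
        ext i
        fin_cases i
        · exact h0
        · exact_mod_cast h1
      apply mul_left_cancel₀ h1
      linear_combination (-(∫ u in c.2..(c.2 + 1), planeChar m (h u) * (h' u).1)) * e1 +
        (∫ u in c.1..(c.1 + 1), planeChar m (f u) * (f' u).1) * e2
    · apply mul_left_cancel₀ (Int.cast_ne_zero.2 h0 : (m 0 : ℂ) ≠ 0)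
      linear_combination (∫ u in c.2..(c.2 + 1), planeChar m (h u) * (h' u).2) * e1 -
        (∫ u in c.1..(c.1 + 1), planeChar m (f u) * (f' u).2) * e2

/-- Both sides of the degree formula are continuous in the test function, so the formula need only
be checked on a dense set. -/
theorem continuous_integral_comp_mul {X : Type*} [TopologicalSpace X] [CompactSpace X]
    {K : Set (ℝ × ℝ)} (hK : IsCompact K) {G : ℝ × ℝ → X} (hG : Continuous G) {w : ℝ × ℝ → ℂ}
    (hw : Continuous w) : Continuous fun φ : C(X, ℂ) => ∫ p in K, φ (G p) * w p := by
  refine continuous_iff_continuousAt.2 fun φ₀ => ?_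
  refine continuousAt_of_dominated (bound := fun p => (‖φ₀‖ + 1) * ‖w p‖)
    (Filter.Eventually.of_forall fun φ => ?_) ?_ ?_ (Filter.Eventually.of_forall fun p => ?_)
  · exact ((φ.continuous.comp hG).mul hw).aestronglyMeasurable
  · have h1 : ∀ᶠ φ : C(X, ℂ) in nhds φ₀, ‖φ‖ < ‖φ₀‖ + 1 :=
      continuous_norm.continuousAt.eventually_lt continuousAt_const (lt_add_one _)
    filter_upwards [h1] with φ hφ
    refine Filter.Eventually.of_forall fun p => ?_
    rw [norm_mul]
    exact mul_le_mul_of_nonneg_right ((φ.norm_coe_le_norm _).trans hφ.le) (norm_nonneg _)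
  · exact (Continuous.continuousOn (by fun_prop)).integrableOn_compact hK
  · exact (continuous_eval_const (F := C(X, ℂ)) (G p)).continuousAt.mul continuousAt_const

/-- The point of the torus `Fin 2 → ℝ / ℤ` given by a point of the plane. -/
def piTorusMk (x : ℝ × ℝ) : UnitAddTorus (Fin 2) := ![(x.1 : UnitAddCircle), (x.2 : UnitAddCircle)]

theorem continuous_piTorusMk : Continuous piTorusMk := by
  refine continuous_pi fun i => ?_
  fin_cases i
  · exact (AddCircle.continuous_mk' 1).comp continuous_fst
  · exact (AddCircle.continuous_mk' 1).comp continuous_snd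

/-- The two coordinate lines sum to the identity map of the plane, with Jacobian 1. The plain
integral of a character is thus a special case of the formula for sums of curves. -/
theorem isQuasiPeriodic_fst : IsQuasiPeriodic (fun u => (u, 0)) (fun _ => (1, 0)) (1, 0) :=
  ⟨fun u => (hasDerivAt_id u).prodMk (hasDerivAt_const u 0), by fun_prop,
    fun u => by simp [latticePoint]⟩

theorem isQuasiPeriodic_snd : IsQuasiPeriodic (fun u => (0, u)) (fun _ => (0, 1)) (0, 1) :=
  ⟨fun u => (hasDerivAt_const u 0).prodMk (hasDerivAt_id u), by fun_prop,
    fun u => by simp [latticePoint]⟩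

/-- The identity is linear and closed in `φ` and holds for characters, whose span is dense by
Stone–Weierstrass. The squares `c` and `c'` are independent, so each can later be placed
conveniently. -/
theorem integral_piTorusMk_mul_jacobian (hf : IsQuasiPeriodic f f' d)
    (hh : IsQuasiPeriodic h h' e) (φ : C(UnitAddTorus (Fin 2), ℂ)) (c c' : ℝ × ℝ) :
    ∫ p in unitSquare c, φ (piTorusMk (f p.1 + h p.2)) * jacobian f' h' p =
      ((d.1 * e.2 - d.2 * e.1 : ℤ) : ℂ) * ∫ p in unitSquare c', φ (piTorusMk p) := by
  have hcf := hf.continuous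
  have hch := hh.continuous
  have hJ := continuous_jacobian hf.continuous_deriv hh.continuous_deriv
  have hclosed : IsClosed {φ : C(UnitAddTorus (Fin 2), ℂ) |
      ∫ p in unitSquare c, φ (piTorusMk (f p.1 + h p.2)) * jacobian f' h' p =
        ((d.1 * e.2 - d.2 * e.1 : ℤ) : ℂ) * ∫ p in unitSquare c', φ (piTorusMk p)} := by
    refine isClosed_eq (continuous_integral_comp_mul (isCompact_unitSquare c)
      (continuous_piTorusMk.comp (by fun_prop)) (by fun_prop)) (continuous_const.mul ?_)
    simpa using continuous_integral_comp_mul (isCompact_unitSquare c') continuous_piTorusMk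
      (w := fun _ => 1) continuous_const
  have hint : ∀ φ : C(UnitAddTorus (Fin 2), ℂ), IntegrableOn
      (fun p => φ (piTorusMk (f p.1 + h p.2)) * (jacobian f' h' p : ℂ)) (unitSquare c) := fun φ =>
    (Continuous.continuousOn ((φ.continuous.comp (continuous_piTorusMk.comp (by fun_prop))).mul
      (by fun_prop))).integrableOn_compact (isCompact_unitSquare c)
  have hint' : ∀ φ : C(UnitAddTorus (Fin 2), ℂ), IntegrableOn
      (fun p => φ (piTorusMk p)) (unitSquare c') := fun φ =>
    (φ.continuous.comp continuous_piTorusMk).continuousOn.integrableOn_compact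
      (isCompact_unitSquare c')
  have hmem : φ ∈ closure
      (Submodule.span ℂ (Set.range (UnitAddTorus.mFourier (d := Fin 2))) : Set _) := by
    rw [← Submodule.topologicalClosure_coe, UnitAddTorus.span_mFourier_closure_eq_top]
    trivial
  refine closure_minimal ?_ hclosed hmem
  intro φ hφ
  induction hφ using Submodule.span_induction with
  | mem φ hφ =>
    obtain ⟨m, rfl⟩ := hφ
    have h0 := integral_planeChar_mul_jacobian isQuasiPeriodic_fst isQuasiPeriodic_snd m c'
    simp only [jacobian, Prod.mk_add_mk, add_zero, zero_add, mul_one, mul_zero, sub_zero,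
      Complex.ofReal_one, Prod.mk.eta] at h0
    simp only [Set.mem_ofPred_eq, piTorusMk, mFourier_eq_planeChar]
    rw [integral_planeChar_mul_jacobian hf hh, h0]
    split_ifs <;> simp
  | zero => simp
  | add φ ψ _ _ h1 h2 =>
    simp only [Set.mem_ofPred_eq, ContinuousMap.add_apply, add_mul] at h1 h2 ⊢
    rw [integral_add (hint φ) (hint ψ), integral_add (hint' φ) (hint' ψ), h1, h2, mul_add]
  | smul z φ _ h1 =>
    simp only [Set.mem_ofPred_eq, ContinuousMap.smul_apply, smul_eq_mul, mul_assoc] at h1 ⊢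
    rw [integral_const_mul, integral_const_mul, h1]
    ring

theorem integral_torusMk_mul_jacobian (hf : IsQuasiPeriodic f f' d)
    (hh : IsQuasiPeriodic h h' e) {ψ : Torus → ℝ} (hψ : Continuous ψ) (c c' : ℝ × ℝ) :
    ∫ p in unitSquare c, ψ (torusMk (f p.1 + h p.2)) * jacobian f' h' p =
      ((d.1 * e.2 - d.2 * e.1 : ℤ) : ℝ) * ∫ p in unitSquare c', ψ (torusMk p) := by
  have key := integral_piTorusMk_mul_jacobian hf hh
    ⟨fun x => ((ψ (x 0, x 1) : ℝ) : ℂ), by fun_prop⟩ c c'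
  have hmk : ∀ x : ℝ × ℝ, ((piTorusMk x 0, piTorusMk x 1) : Torus) = torusMk x := fun x => rfl
  simp only [ContinuousMap.coe_mk, hmk, ← Complex.ofReal_mul] at key
  exact_mod_cast key

end

end Goldman

namespace Goldman

open MeasureTheory

/-! ### The signed count of zeros -/

/-- The derivative of `(s, t) ↦ f s + h t` at a point where `f`, `h` have derivatives `v`, `w`. -/
noncomputable def sumDeriv (v w : ℝ × ℝ) : ℝ × ℝ →L[ℝ] ℝ × ℝ :=
  (ContinuousLinearMap.fst ℝ ℝ ℝ).smulRight v + (ContinuousLinearMap.snd ℝ ℝ ℝ).smulRight w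

theorem det_sumDeriv (v w : ℝ × ℝ) : (sumDeriv v w).det = v.1 * w.2 - v.2 * w.1 := by
  rw [ContinuousLinearMap.det, ← LinearMap.det_toMatrix (Module.Basis.finTwoProd ℝ),
    Matrix.det_fin_two]
  simp [LinearMap.toMatrix_apply, sumDeriv]
  ring

/-- Near the origin the projection preserves norms. This isolates the zeros and lets the bump be
computed in the plane. -/
theorem norm_torusMk {x : ℝ × ℝ} (hx : ‖x‖ ≤ 1 / 2) : ‖torusMk x‖ = ‖x‖ := by
  have h : ∀ r : ℝ, ‖r‖ ≤ 1 / 2 → ‖(r : UnitAddCircle)‖ = ‖r‖ := fun r hr =>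
    (AddCircle.norm_coe_eq_abs_iff 1 one_ne_zero).2 (by simpa using hr)
  rw [Prod.norm_def, Prod.norm_def, torusMk, h _ ((norm_fst_le x).trans hx),
    h _ ((norm_snd_le x).trans hx)]

section

variable {f f' h h' : ℝ → ℝ × ℝ} {d e : ℤ × ℤ}

theorem IsQuasiPeriodic.hasStrictDerivAt (hf : IsQuasiPeriodic f f' d) (u : ℝ) :
    HasStrictDerivAt f (f' u) u :=
  hasStrictDerivAt_of_hasDerivAt_of_continuousAt (Filter.Eventually.of_forall hf.hasDerivAt)
    hf.continuous_deriv.continuousAt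

theorem hasStrictFDerivAt_sum (hf : IsQuasiPeriodic f f' d) (hh : IsQuasiPeriodic h h' e)
    (p : ℝ × ℝ) :
    HasStrictFDerivAt (fun p : ℝ × ℝ => f p.1 + h p.2) (sumDeriv (f' p.1) (h' p.2)) p := by
  have h1 := (hf.hasStrictDerivAt p.1).hasStrictFDerivAt.comp p hasStrictFDerivAt_fst
  have h2 := (hh.hasStrictDerivAt p.2).hasStrictFDerivAt.comp p hasStrictFDerivAt_snd
  exact h1.add h2

/-- The inverse function theorem, on a neighbourhood shrunk so that the sign of the Jacobian is
constant and the values stay too close together to differ by a nonzero lattice vector. -/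
theorem exists_local_inverse_domain (hf : IsQuasiPeriodic f f' d) (hh : IsQuasiPeriodic h h' e)
    {p : ℝ × ℝ} (hp : jacobian f' h' p ≠ 0) {W : Set (ℝ × ℝ)} (hW : W ∈ nhds p) :
    ∃ U ⊆ W, IsOpen U ∧ p ∈ U ∧ Set.InjOn (fun q : ℝ × ℝ => f q.1 + h q.2) U ∧
      (∀ q ∈ U, SignType.sign (jacobian f' h' q) = SignType.sign (jacobian f' h' p)) ∧
      (∀ q ∈ U, ‖(f q.1 + h q.2) - (f p.1 + h p.2)‖ < 1 / 2) ∧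
      (fun q : ℝ × ℝ => f q.1 + h q.2) '' U ∈ nhds (f p.1 + h p.2) := by
  have hcf := hf.continuous
  have hch := hh.continuous
  have hJ := continuous_jacobian hf.continuous_deriv hh.continuous_deriv
  have hdet : (sumDeriv (f' p.1) (h' p.2)).det ≠ 0 := by rwa [det_sumDeriv]
  have hF : HasStrictFDerivAt (fun q : ℝ × ℝ => f q.1 + h q.2)
      (((sumDeriv (f' p.1) (h' p.2)).toContinuousLinearEquivOfDetNeZero hdet :
        (ℝ × ℝ) ≃L[ℝ] ℝ × ℝ) : ℝ × ℝ →L[ℝ] ℝ × ℝ) p := by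
    rw [ContinuousLinearMap.coe_toContinuousLinearEquivOfDetNeZero]
    exact hasStrictFDerivAt_sum hf hh p
  have hsource : hF.toOpenPartialHomeomorph.source ∈ nhds p :=
    hF.toOpenPartialHomeomorph.open_source.mem_nhds hF.mem_toOpenPartialHomeomorph_source
  have hsign : ∀ᶠ q in nhds p,
      SignType.sign (jacobian f' h' q) = SignType.sign (jacobian f' h' p) := by
    rcases hp.lt_or_gt with h0 | h0
    · filter_upwards [hJ.continuousAt.eventually_lt continuousAt_const h0] with q hq
      rw [sign_neg hq, sign_neg h0]
    · filter_upwards [continuousAt_const.eventually_lt hJ.continuousAt h0] with q hq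
      rw [sign_pos hq, sign_pos h0]
  have hnorm : ∀ᶠ q in nhds p, ‖(f q.1 + h q.2) - (f p.1 + h p.2)‖ < 1 / 2 := by
    refine ContinuousAt.eventually_lt (Continuous.continuousAt (by fun_prop))
      continuousAt_const ?_
    simp
  obtain ⟨U, hU, hUo, hpU⟩ := mem_nhds_iff.1
    (Filter.inter_mem (Filter.inter_mem hW hsource) (Filter.inter_mem hsign hnorm))
  refine ⟨U, fun q hq => (hU hq).1.1, hUo, hpU, ?_, fun q hq => (hU hq).2.1,
    fun q hq => (hU hq).2.2, ?_⟩
  · have := hF.toOpenPartialHomeomorph.injOn.mono fun q hq => (hU hq).1.2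
    rwa [hF.toOpenPartialHomeomorph_coe] at this
  · rw [← hF.map_nhds_eq_of_equiv]
    exact Filter.image_mem_map (hUo.mem_nhds hpU)

/-! ### Localisation of the degree formula at the zeros -/

/-- A bump function on the torus, supported in the ball of radius `ε` about `0`. -/
noncomputable def torusBump (ε : ℝ) (x : Torus) : ℝ := max 0 (ε - ‖x‖)

theorem continuous_torusBump (ε : ℝ) : Continuous (torusBump ε) := by
  unfold torusBump
  fun_prop

theorem torusBump_nonneg (ε : ℝ) (x : Torus) : 0 ≤ torusBump ε x := le_max_left _ _

theorem torusBump_eq_zero {ε : ℝ} {x : Torus} (hx : ε ≤ ‖x‖) : torusBump ε x = 0 :=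
  max_eq_left (by linarith)

/-- Every point of `S` is within 1/2 of the lattice point `x`, so there the bump depends only on the
distance to `x` and vanishes off the ball. Translation by `x` then moves the ball to the origin. -/
theorem setIntegral_torusBump_eq {ε : ℝ} {x : ℝ × ℝ} (hx : torusMk x = 0) {S : Set (ℝ × ℝ)}
    (hS : MeasurableSet S) (hball : Metric.ball x ε ⊆ S) (hS' : ∀ y ∈ S, ‖y - x‖ ≤ 1 / 2) :
    ∫ y in S, torusBump ε (torusMk y) =
      ∫ y in Metric.ball 0 ε, torusBump ε (torusMk y) := by
  rw [setIntegral_eq_of_subset_of_forall_sdiff_eq_zero hS hball]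
  · have h1 : Metric.ball (0 : ℝ × ℝ) ε = (fun y => y + x) ⁻¹' Metric.ball x ε := by
      ext y
      simp
    have h2 := (measurePreserving_add_right (volume : Measure (ℝ × ℝ)) x).setIntegral_preimage_emb
      (measurableEmbedding_addRight x) (fun y => torusBump ε (torusMk y)) (Metric.ball x ε)
    rw [← h2, ← h1]
    simp only [torusMk_add, hx, add_zero]
  · rintro y ⟨hy, hy'⟩
    apply torusBump_eq_zero
    have h1 : torusMk y = torusMk (y - x) := by rw [torusMk_sub, hx, sub_zero]
    rw [h1, norm_torusMk (hS' y hy)]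
    rwa [mem_ball_iff_norm, not_lt] at hy'

theorem setIntegral_torusBump_pos {ε : ℝ} (hε : 0 < ε) (hε' : ε ≤ 1 / 2) :
    0 < ∫ y in Metric.ball (0 : ℝ × ℝ) ε, torusBump ε (torusMk y) := by
  have hc : Continuous fun y : ℝ × ℝ => torusBump ε (torusMk y) :=
    (continuous_torusBump ε).comp continuous_torusMk
  rw [setIntegral_pos_iff_support_of_nonneg_ae
    (Filter.Eventually.of_forall fun y => torusBump_nonneg ε (torusMk y))
    ((hc.continuousOn.integrableOn_compact (isCompact_closedBall 0 ε)).mono_set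
      Metric.ball_subset_closedBall)]
  have h1 : Function.support (fun y : ℝ × ℝ => torusBump ε (torusMk y)) ∩ Metric.ball 0 ε =
      Metric.ball 0 ε := by
    refine Set.inter_eq_right.2 fun y hy => ?_
    rw [mem_ball_zero_iff] at hy
    rw [Function.mem_support, torusBump, norm_torusMk (hy.le.trans hε')]
    exact (lt_max_of_lt_right (by linarith)).ne'
  rw [h1]
  exact Metric.measure_ball_pos _ _ hε

/-- For a bump of small radius the integral in the degree formula lives on disjoint neighbourhoods
of the zeros, each contributing its sign times the mass `I` of the bump. Dividing by `I > 0` leaves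
the signed count. -/
theorem sum_sign_jacobian (hf : IsQuasiPeriodic f f' d) (hh : IsQuasiPeriodic h h' e)
    {c : ℝ × ℝ} {Z : Finset (ℝ × ℝ)}
    (hZ : ∀ p ∈ unitSquare c, torusMk (f p.1 + h p.2) = 0 → p ∈ Z)
    (hZ0 : ∀ p ∈ Z, torusMk (f p.1 + h p.2) = 0)
    (hZc : ∀ p ∈ Z, p ∈ interior (unitSquare c))
    (hJ : ∀ p ∈ Z, jacobian f' h' p ≠ 0) :
    ∑ p ∈ Z, ((SignType.sign (jacobian f' h' p) : SignType) : ℤ) = d.1 * e.2 - d.2 * e.1 := by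
  classical
  have hcf := hf.continuous
  have hch := hh.continuous
  have hJc := continuous_jacobian hf.continuous_deriv hh.continuous_deriv
  obtain ⟨V, hV, hVd⟩ := Z.finite_toSet.t2_separation
  -- Because zeros are interior, the neighbourhoods fit inside the square and no zero is cut by its
  -- boundary.
  have hloc := fun p (hp : p ∈ Z) => exists_local_inverse_domain hf hh (hJ p hp)
    (Filter.inter_mem ((hV p).2.mem_nhds (hV p).1) (isOpen_interior.mem_nhds (hZc p hp)))
  choose! U hUV hUo hpU hinj hsign hnorm himage using hloc
  have hUm : ∀ p ∈ Z, MeasurableSet (U p) := fun p hp => (hUo p hp).measurableSet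
  have hUsub : ⋃ p ∈ Z, U p ⊆ unitSquare c :=
    Set.iUnion₂_subset fun p hp q hq => interior_subset (hUV p hp hq).2
  have hUd : (Z : Set (ℝ × ℝ)).Pairwise (Function.onFun Disjoint U) := fun p hp q hq hpq =>
    (hVd hp hq hpq).mono (fun x hx => (hUV p hp hx).1) (fun x hx => (hUV q hq hx).1)
  -- a radius `ε` for which the preimage of the ball is contained in the union of the `U p`
  obtain ⟨ε, hε, hεhalf, hεaway, hεball⟩ : ∃ ε : ℝ, 0 < ε ∧ ε ≤ 1 / 2 ∧
      (∀ p ∈ unitSquare c \ ⋃ p ∈ Z, U p, ε ≤ ‖torusMk (f p.1 + h p.2)‖) ∧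
      ∀ p ∈ Z, Metric.ball (f p.1 + h p.2) ε ⊆ (fun q : ℝ × ℝ => f q.1 + h q.2) '' U p := by
    -- The part of the square outside the neighbourhoods is compact and free of zeros, so its image
    -- stays a positive distance from 0.
    have hK : IsCompact ((fun p : ℝ × ℝ => torusMk (f p.1 + h p.2)) ''
        (unitSquare c \ ⋃ p ∈ Z, U p)) :=
      ((isCompact_unitSquare c).diff (isOpen_biUnion hUo)).image
        (continuous_torusMk.comp (by fun_prop))
    have h0 : (0 : Torus) ∈ ((fun p : ℝ × ℝ => torusMk (f p.1 + h p.2)) ''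
        (unitSquare c \ ⋃ p ∈ Z, U p))ᶜ := by
      rintro ⟨p, ⟨hp, hpU'⟩, hp0⟩
      have hpZ := hZ p hp hp0
      exact hpU' (Set.mem_biUnion hpZ (hpU p hpZ))
    obtain ⟨ε₀, hε₀, hball₀⟩ := Metric.isOpen_iff.1 hK.isClosed.isOpen_compl 0 h0
    have hr : ∀ p ∈ Z, ∃ r > 0, Metric.ball (f p.1 + h p.2) r ⊆
        (fun q : ℝ × ℝ => f q.1 + h q.2) '' U p := fun p hp => Metric.mem_nhds_iff.1 (himage p hp)
    choose! r hr hrball using hr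
    have hev : ∀ᶠ ε in nhdsWithin (0 : ℝ) (Set.Ioi 0), ∀ p ∈ Z, ε ≤ r p :=
      (Filter.eventually_all_finset Z).2 fun p hp =>
        Filter.mem_of_superset (Ioc_mem_nhdsGT (hr p hp)) fun x hx => hx.2
    obtain ⟨ε, hε1, hε2, hε3⟩ := (hev.and ((Filter.eventually_of_mem (Ioc_mem_nhdsGT hε₀)
      fun x hx => hx).and (Filter.eventually_of_mem
        (Ioc_mem_nhdsGT (by norm_num : (0 : ℝ) < 1 / 2)) fun x hx => hx))).exists
    refine ⟨ε, hε2.1, hε3.2, fun p hp => ?_, fun p hp =>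
      (Metric.ball_subset_ball (hε1 p hp)).trans (hrball p hp)⟩
    by_contra! hlt
    exact hball₀ (mem_ball_zero_iff.2 (hlt.trans_le hε2.2)) ⟨p, hp, rfl⟩
  have hψ := continuous_torusBump ε
  have hψF : Continuous fun p : ℝ × ℝ => torusBump ε (torusMk (f p.1 + h p.2)) :=
    hψ.comp (continuous_torusMk.comp (by fun_prop))
  set I := ∫ y in Metric.ball (0 : ℝ × ℝ) ε, torusBump ε (torusMk y) with hI
  have hIpos : 0 < I := setIntegral_torusBump_pos hε hεhalf
  -- The square centred at the origin lies within 1/2 of the lattice point 0, so its integral is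
  -- exactly `I`.
  have hsquare : ∫ p in unitSquare (-(1 / 2), -(1 / 2)), torusBump ε (torusMk p) = I := by
    refine setIntegral_torusBump_eq (x := 0) rfl (isCompact_unitSquare _).isClosed.measurableSet
      (fun y hy => ?_) (fun y hy => ?_)
    · rw [mem_ball_zero_iff, Prod.norm_def, max_lt_iff, Real.norm_eq_abs, Real.norm_eq_abs,
        abs_lt, abs_lt] at hy
      obtain ⟨⟨h1, h2⟩, h3, h4⟩ := hy
      refine ⟨⟨?_, ?_⟩, ?_, ?_⟩ <;> linarith
    · obtain ⟨⟨h1, h2⟩, h3, h4⟩ := hy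
      rw [sub_zero, Prod.norm_def, max_le_iff, Real.norm_eq_abs, Real.norm_eq_abs, abs_le, abs_le]
      refine ⟨⟨?_, ?_⟩, ?_, ?_⟩ <;> linarith
  have hpiece : ∀ p ∈ Z,
      ∫ q in U p, torusBump ε (torusMk (f q.1 + h q.2)) * jacobian f' h' q =
        ((SignType.sign (jacobian f' h' p) : SignType) : ℝ) * I := by
    intro p hp
    have hder : ∀ q ∈ U p, HasFDerivWithinAt (fun q : ℝ × ℝ => f q.1 + h q.2)
        (sumDeriv (f' q.1) (h' q.2)) (U p) q := fun q _ =>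
      (hasStrictFDerivAt_sum hf hh q).hasFDerivAt.hasFDerivWithinAt
    have hchange := integral_image_eq_integral_abs_det_fderiv_smul volume (hUm p hp) hder
      (hinj p hp) fun y => torusBump ε (torusMk y)
    rw [setIntegral_torusBump_eq (hZ0 p hp)
      (measurable_image_of_fderivWithin (hUm p hp) hder (hinj p hp)) (hεball p hp)
      (by rintro _ ⟨q, hq, rfl⟩; exact (hnorm p hp q hq).le)] at hchange
    rw [hI, hchange, ← integral_const_mul]
    refine setIntegral_congr_fun (hUm p hp) fun q hq => ?_
    simp only [det_sumDeriv, smul_eq_mul]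
    -- The change of variables produces the absolute Jacobian; the locally constant sign restores
    -- the signed one.
    rw [← hsign p hp q hq, ← mul_assoc]
    change _ = (SignType.sign (jacobian f' h' q) : ℝ) * |jacobian f' h' q| * _
    rw [sign_mul_abs, mul_comm]
  have hint : IntegrableOn (fun p : ℝ × ℝ => torusBump ε (torusMk (f p.1 + h p.2)) *
      jacobian f' h' p) (unitSquare c) :=
    (hψF.mul hJc).continuousOn.integrableOn_compact (isCompact_unitSquare c)
  have htotal := integral_torusMk_mul_jacobian hf hh hψ c (-(1 / 2), -(1 / 2))
  rw [hsquare, setIntegral_eq_of_subset_of_forall_sdiff_eq_zero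
    (isCompact_unitSquare c).isClosed.measurableSet hUsub
    (fun p hp => by rw [torusBump_eq_zero (hεaway p hp), zero_mul]),
    integral_biUnion_finset Z hUm hUd fun p hp =>
      hint.mono_set ((Set.subset_biUnion_of_mem (u := U) hp).trans hUsub),
    Finset.sum_congr rfl hpiece, ← Finset.sum_mul] at htotal
  have hfinal := mul_right_cancel₀ hIpos.ne' htotal
  have hcast : ∀ σ : SignType, ((σ : ℤ) : ℝ) = (σ : ℝ) := fun σ => by cases σ <;> simp
  apply Int.cast_injective (α := ℝ)
  rw [← hfinal, Int.cast_sum]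
  exact Finset.sum_congr rfl fun p _ => hcast _

end

end Goldman

namespace Goldman

/-! ### Smooth loops on the torus and their lifts -/

/-- In charts the projection is locally a translation, so smoothness and velocities of loops are
those of their lifts. -/
theorem torusChart_torusMk (x : ℝ × ℝ) :
    ∃ c : ℝ × ℝ, ∀ᶠ y in nhds x, chartAt (ℝ × ℝ) (torusMk x) (torusMk y) = y + c := by
  obtain ⟨c, hc⟩ := circleChart_transition 0 _ x.1 (mem_circleChart_source (x.1 : UnitAddCircle))
  obtain ⟨d, hd⟩ := circleChart_transition 0 _ x.2 (mem_circleChart_source (x.2 : UnitAddCircle))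
  refine ⟨(c, d), ?_⟩
  filter_upwards [hc.prod_nhds hd] with y hy
  exact Prod.ext hy.1 hy.2

theorem contMDiff_torusMk_comp_iff {f : ℝ → ℝ × ℝ} (hf : Continuous f) :
    ContMDiff 𝓘(ℝ, ℝ) 𝓘(ℝ, ℝ × ℝ) ∞ (fun u => torusMk (f u)) ↔ ContDiff ℝ ∞ f := by
  rw [contDiff_iff_contDiffAt]
  refine forall_congr' fun u => ?_
  obtain ⟨c, hc⟩ := torusChart_torusMk (f u)
  have hc' : (fun v => chartAt (ℝ × ℝ) (torusMk (f u)) (torusMk (f v))) =ᶠ[nhds u]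
      fun v => f v + c := hf.continuousAt.eventually hc
  rw [contMDiffAt_iff]
  simp only [mfld_simps, contDiffWithinAt_univ]
  constructor
  · rintro ⟨-, h⟩
    have h1 : ContDiffAt ℝ ∞ (fun v => f v + c) u := h.congr_of_eventuallyEq hc'.symm
    simpa using h1.sub (contDiffAt_const (c := c))
  · intro h
    exact ⟨(continuous_torusMk.comp hf).continuousAt,
      (h.add contDiffAt_const).congr_of_eventuallyEq hc'⟩

theorem IsLift.isSmoothLoop_iff {α : Loop Torus} {f : ℝ → ℝ × ℝ} {d : ℤ × ℤ}
    (hf : IsLift α f d) : IsSmoothLoop α ↔ ContDiff ℝ ∞ f := by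
  rw [← contMDiff_torusMk_comp_iff hf.continuous, IsSmoothLoop]
  simp only [hf.mk_apply]

theorem IsLift.velocity_eq {α : Loop Torus} {f : ℝ → ℝ × ℝ} {d : ℤ × ℤ} (hf : IsLift α f d)
    {u : ℝ} {v : ℝ × ℝ} (hv : HasDerivAt f v u) : velocity α (u : UnitAddCircle) = v := by
  have hlift : (fun w : ℝ => α ((u : UnitAddCircle) + (w : UnitAddCircle))) =
      fun w => torusMk (f (u + w)) := by
    funext w
    rw [hf.mk_apply, AddCircle.coe_add]
  have hcont : Continuous fun w => f (u + w) := hf.continuous.comp (by fun_prop)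
  obtain ⟨c, hc⟩ := torusChart_torusMk (f (u + 0))
  have hc' : (fun w => chartAt (ℝ × ℝ) (torusMk (f (u + 0))) (torusMk (f (u + w)))) =ᶠ[nhds 0]
      fun w => f (u + w) + c := hcont.continuousAt.eventually hc
  have hder : HasFDerivAt (fun w => f (u + w) + c) (ContinuousLinearMap.toSpanSingleton ℝ v) 0 := by
    have h0 : HasDerivAt f v (u + 0) := by rwa [add_zero]
    exact ((h0.comp_const_add u 0).add_const c).hasFDerivAt
  have hm : HasMFDerivAt 𝓘(ℝ, ℝ) 𝓘(ℝ, ℝ × ℝ)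
      (fun w : ℝ => α ((u : UnitAddCircle) + (w : UnitAddCircle))) 0
      (ContinuousLinearMap.toSpanSingleton ℝ v) := by
    rw [hlift]
    refine ⟨(continuous_torusMk.comp hcont).continuousAt, ?_⟩
    simp only [mfld_simps]
    exact HasFDerivAt.hasFDerivWithinAt <| hder.congr_of_eventuallyEq hc'
  rw [velocity, hm.mfderiv]
  exact (ContinuousLinearMap.toSpanSingleton_apply ℝ v 1).trans (one_smul ℝ v)

theorem IsLift.isQuasiPeriodic {α : Loop Torus} {f : ℝ → ℝ × ℝ} {d : ℤ × ℤ} (hf : IsLift α f d)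
    (hα : IsSmoothLoop α) : IsQuasiPeriodic f (deriv f) d where
  hasDerivAt u := ((hf.isSmoothLoop_iff.1 hα).differentiable (by simp) u).hasDerivAt
  continuous_deriv := (hf.isSmoothLoop_iff.1 hα).continuous_deriv (by simp)
  add_one := hf.add_one

/-- This turns the difference of two lifts, whose zeros are the intersections, into a sum of
quasi-periodic curves. -/
theorem IsQuasiPeriodic.neg {f f' : ℝ → ℝ × ℝ} {d : ℤ × ℤ} (hf : IsQuasiPeriodic f f' d) :
    IsQuasiPeriodic (-f) (-f') (-d) where
  hasDerivAt u := (hf.hasDerivAt u).neg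
  continuous_deriv := hf.continuous_deriv.neg
  add_one u := by
    have h : latticePoint (-d) = -latticePoint d := by simp [latticePoint]
    rw [Pi.neg_apply, Pi.neg_apply, hf.add_one, h, neg_add]

/-! ### The intersections of two transverse loops on the torus -/

section

variable {f f' h h' : ℝ → ℝ × ℝ} {d e : ℤ × ℤ}

/-- Zeros are isolated: at two zeros in one local domain the values differ by a lattice vector of
norm below 1/2, so they agree and injectivity applies. Compactness of the square gives finiteness.
-/
theorem finite_zeros_unitSquare (hf : IsQuasiPeriodic f f' d) (hh : IsQuasiPeriodic h h' e)
    (hJ : ∀ p : ℝ × ℝ, torusMk (f p.1 + h p.2) = 0 → jacobian f' h' p ≠ 0) (c : ℝ × ℝ) :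
    {p ∈ unitSquare c | torusMk (f p.1 + h p.2) = 0}.Finite := by
  have hcf := hf.continuous
  have hch := hh.continuous
  have hcomp : IsCompact {p ∈ unitSquare c | torusMk (f p.1 + h p.2) = 0} :=
    (isCompact_unitSquare c).inter_right
      (isClosed_eq (continuous_torusMk.comp (by fun_prop)) continuous_const)
  have hloc := fun p (hp : torusMk (f p.1 + h p.2) = 0) =>
    exists_local_inverse_domain hf hh (hJ p hp) Filter.univ_mem
  choose! U _ hUo hpU hinj _ hnorm _ using hloc
  obtain ⟨t, ht, hcover⟩ := hcomp.elim_nhds_subcover U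
    fun p hp => (hUo p hp.2).mem_nhds (hpU p hp.2)
  refine t.finite_toSet.subset fun q hq => ?_
  obtain ⟨p, hp, hqp⟩ := Set.mem_iUnion₂.1 (hcover hq)
  have hp0 := (ht p hp).2
  have h1 := norm_torusMk (hnorm p hp0 q hqp).le
  rw [torusMk_sub, hq.2, hp0, sub_zero, norm_zero] at h1
  have h2 : q = p := hinj p hp0 hqp (hpU p hp0) (sub_eq_zero.1 (norm_eq_zero.1 h1.symm))
  exact h2 ▸ hp

end

theorem exists_mem_unitSquare (c : ℝ × ℝ) (x : Torus) : ∃ p ∈ unitSquare c, torusMk p = x := by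
  have h : ∀ (r : ℝ) (y : UnitAddCircle), ∃ t ∈ Set.Icc r (r + 1), (t : UnitAddCircle) = y :=
    fun r y => ⟨AddCircle.equivIco 1 r y, Set.Ico_subset_Icc_self (AddCircle.equivIco 1 r y).2,
      AddCircle.coe_equivIco⟩
  obtain ⟨s, hs, hs'⟩ := h c.1 x.1
  obtain ⟨t, ht, ht'⟩ := h c.2 x.2
  exact ⟨(s, t), ⟨hs, ht⟩, Prod.ext hs' ht'⟩

instance : Infinite UnitAddCircle :=
  have : Infinite (Set.Ico (0 : ℝ) (0 + 1)) := (Set.Ico_infinite (by norm_num)).to_subtype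
  (AddCircle.equivIco (1 : ℝ) 0).symm.infinite_iff.1 this

/-- A finite subset of the torus lies in the interior of some fundamental unit square. -/
theorem exists_unitSquare_interior {S : Set Torus} (hS : S.Finite) :
    ∃ c, ∀ p ∈ unitSquare c, torusMk p ∈ S → p ∈ interior (unitSquare c) := by
  have key : ∀ A : Set UnitAddCircle, A.Finite → ∃ r : ℝ, ∀ t ∈ Set.Icc r (r + 1),
      (t : UnitAddCircle) ∈ A → t ∈ Set.Ioo r (r + 1) := by
    intro A hA
    -- Both endpoints of `[r, r + 1]` project to `y`, so choosing `y` outside `A` keeps them away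
    -- from `A`.
    obtain ⟨y, hy⟩ := hA.exists_notMem
    obtain ⟨r, rfl⟩ := QuotientAddGroup.mk_surjective y
    refine ⟨r, fun t ht htA => ⟨ht.1.lt_of_ne ?_, ht.2.lt_of_ne ?_⟩⟩
    · rintro rfl
      exact hy htA
    · rintro rfl
      rw [AddCircle.coe_add_period 1 r] at htA
      exact hy htA
  obtain ⟨r, hr⟩ := key _ (hS.image Prod.fst)
  obtain ⟨r', hr'⟩ := key _ (hS.image Prod.snd)
  refine ⟨(r, r'), fun p hp hpS => ?_⟩
  rw [unitSquare, interior_prod_eq, interior_Icc, interior_Icc]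
  exact ⟨hr _ hp.1 ⟨_, hpS, rfl⟩, hr' _ hp.2 ⟨_, hpS, rfl⟩⟩

theorem torusMk_injOn_interior (c : ℝ × ℝ) : Set.InjOn torusMk (interior (unitSquare c)) := by
  rw [unitSquare, interior_prod_eq, interior_Icc, interior_Icc]
  rintro p hp q hq hpq
  have key : ∀ r s t : ℝ, s ∈ Set.Ioo r (r + 1) → t ∈ Set.Ioo r (r + 1) →
      (s : UnitAddCircle) = t → s = t := fun r s t hs ht hst =>
    (AddCircle.coe_eq_coe_iff_of_mem_Ico (p := (1 : ℝ)) (Set.Ioo_subset_Ico_self hs)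
      (Set.Ioo_subset_Ico_self ht)).1 hst
  exact Prod.ext (key _ _ _ hp.1 hq.1 (congrArg Prod.fst hpq))
    (key _ _ _ hp.2 hq.2 (congrArg Prod.snd hpq))

theorem IsLift.torusMk_mem_intersections {α β : Loop Torus} {f g : ℝ → ℝ × ℝ} {d e : ℤ × ℤ}
    (hf : IsLift α f d) (hg : IsLift β g e) (p : ℝ × ℝ) :
    torusMk p ∈ intersections α β ↔ torusMk (f p.1 + (-g) p.2) = 0 := by
  rw [Pi.neg_apply, ← sub_eq_add_neg, torusMk_sub, sub_eq_zero, hf.mk_apply, hg.mk_apply]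
  rfl

theorem IsLift.crossing_eq {α β : Loop Torus} {f g f' g' : ℝ → ℝ × ℝ} {d e : ℤ × ℤ}
    (hf : IsLift α f d) (hg : IsLift β g e) (hf' : ∀ u, HasDerivAt f (f' u) u)
    (hg' : ∀ u, HasDerivAt g (g' u) u) (p : ℝ × ℝ) :
    crossing α β (torusMk p).1 (torusMk p).2 = -jacobian f' (-g') p := by
  simp only [crossing, torusMk, hf.velocity_eq (hf' _), hg.velocity_eq (hg' _), jacobian,
    Pi.neg_apply, Prod.fst_neg, Prod.snd_neg]
  ring

theorem AreTransverse.finite_intersections {α β : Loop Torus} (H : AreTransverse α β) :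
    (intersections α β).Finite := by
  obtain ⟨f, hf⟩ := exists_isLift_loopDegree α
  obtain ⟨g, hg⟩ := exists_isLift_loopDegree β
  have qf := hf.isQuasiPeriodic H.smooth_left
  have qg := hg.isQuasiPeriodic H.smooth_right
  refine ((finite_zeros_unitSquare qf qg.neg (fun p hp => ?_) 0).image torusMk).subset
    fun x hx => ?_
  · have h1 := H.crossing_ne_zero _ ((hf.torusMk_mem_intersections hg p).2 hp)
    rw [hf.crossing_eq hg qf.hasDerivAt qg.hasDerivAt] at h1
    exact neg_ne_zero.1 h1
  · obtain ⟨p, hp, rfl⟩ := exists_mem_unitSquare 0 x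
    exact ⟨p, ⟨hp, (hf.torusMk_mem_intersections hg p).1 hx⟩, rfl⟩

theorem AreTransverse.sum_sign_crossing {α β : Loop Torus} (H : AreTransverse α β) :
    ∑ p ∈ H.finite_intersections.toFinset, ((SignType.sign (crossing α β p.1 p.2) : SignType) : ℤ) =
      (loopDegree α).1 * (loopDegree β).2 - (loopDegree α).2 * (loopDegree β).1 := by
  classical
  obtain ⟨f, hf⟩ := exists_isLift_loopDegree α
  obtain ⟨g, hg⟩ := exists_isLift_loopDegree β
  have qf := hf.isQuasiPeriodic H.smooth_left
  have qg := hg.isQuasiPeriodic H.smooth_right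
  have hJ : ∀ p : ℝ × ℝ, torusMk (f p.1 + (-g) p.2) = 0 →
      jacobian (deriv f) (-deriv g) p ≠ 0 := fun p hp => by
    have h1 := H.crossing_ne_zero _ ((hf.torusMk_mem_intersections hg p).2 hp)
    rw [hf.crossing_eq hg qf.hasDerivAt qg.hasDerivAt] at h1
    exact neg_ne_zero.1 h1
  obtain ⟨c, hc⟩ := exists_unitSquare_interior H.finite_intersections
  have hfin := finite_zeros_unitSquare qf qg.neg hJ c
  have hint : ∀ p ∈ hfin.toFinset, p ∈ interior (unitSquare c) := fun p hp => by
    have hp := hfin.mem_toFinset.1 hp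
    exact hc p hp.1 ((hf.torusMk_mem_intersections hg p).2 hp.2)
  have himage : H.finite_intersections.toFinset = hfin.toFinset.image torusMk := by
    ext x
    simp only [Set.Finite.mem_toFinset, Finset.mem_image]
    constructor
    · intro hx
      obtain ⟨p, hp, rfl⟩ := exists_mem_unitSquare c x
      exact ⟨p, ⟨hp, (hf.torusMk_mem_intersections hg p).1 hx⟩, rfl⟩
    · rintro ⟨p, hp, rfl⟩
      exact (hf.torusMk_mem_intersections hg p).2 hp.2
  have key := sum_sign_jacobian qf qg.neg (c := c) (Z := hfin.toFinset)
    (fun p hp hp0 => hfin.mem_toFinset.2 ⟨hp, hp0⟩) (fun p hp => (hfin.mem_toFinset.1 hp).2)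
    hint (fun p hp => hJ p (hfin.mem_toFinset.1 hp).2)
  rw [himage, Finset.sum_image fun p hp q hq h => torusMk_injOn_interior c (hint p hp) (hint q hq) h]
  -- Replacing `g` by `-g` negates both the crossing signs and the second degree, so the two minus
  -- signs cancel.
  simp only [hf.crossing_eq hg qf.hasDerivAt qg.hasDerivAt, Left.sign_neg, SignType.coe_neg,
    Finset.sum_neg_distrib, key, Prod.fst_neg, Prod.snd_neg]
  ring

/-! ### The Goldman bracket on the torus -/

theorem word_loopDegree (α : Loop Torus) :
    word (loopDegree α).1 (loopDegree α).2 = freeClass α :=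
  classDegree_injective (by simp)

/-- By additivity of the degree every product loop has the same class, so only the sum of the signs
matters. -/
theorem AreTransverse.intersectionSum_eq (R : Type*) [CommRing R] {α β : Loop Torus}
    (H : AreTransverse α β) {i j k l : ℤ} (hα : freeClass α = word i j)
    (hβ : freeClass β = word k l) :
    intersectionSum R α β =
      ((i * l - j * k : ℤ) : R) • Finsupp.single (word (i + k) (j + l)) 1 := by
  have dα : loopDegree α = (i, j) := by rw [← classDegree_freeClass, hα, classDegree_word]
  have dβ : loopDegree β = (k, l) := by rw [← classDegree_freeClass, hβ, classDegree_word]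
  have hterm : ∀ p : intersections α β,
      Finsupp.single (freeClass (loopProduct α β p.1.1 p.1.2 p.2))
        (((SignType.sign (crossing α β p.1.1 p.1.2) : SignType) : ℤ) : R) =
      ((SignType.sign (crossing α β p.1.1 p.1.2) : SignType) : ℤ) •
        Finsupp.single (word (i + k) (j + l)) (1 : R) := fun p => by
    have hw : freeClass (loopProduct α β p.1.1 p.1.2 p.2) = word (i + k) (j + l) :=
      classDegree_injective <| (loopDegree_loopProduct α β _ _ p.2).trans <| by
        rw [dα, dβ, classDegree_word]
        rfl
    rw [hw, Finsupp.smul_single, zsmul_one]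
  rw [intersectionSum, finsum_congr hterm,
    finsum_set_coe_eq_finsum_mem (f := fun p : Torus =>
      ((SignType.sign (crossing α β p.1 p.2) : SignType) : ℤ) •
        Finsupp.single (word (i + k) (j + l)) (1 : R)),
    finsum_mem_eq_finite_toFinset_sum _ H.finite_intersections, ← Finset.sum_smul,
    H.sum_sign_crossing, dα, dβ, Finsupp.smul_single, Finsupp.smul_single, zsmul_one,
    smul_eq_mul, mul_one]

/-! ### Transverse representatives and the bracket -/

/-- The loop on the torus covered by the line `u ↦ d u + v`. -/
noncomputable def linearLoop (d : ℤ × ℤ) (v : Torus) : Loop Torus where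
  toFun c := (d.1 • c, d.2 • c) + v
  continuous_toFun := by fun_prop

theorem isLift_linearLoop (d : ℤ × ℤ) (v : ℝ × ℝ) :
    IsLift (linearLoop d (torusMk v)) (fun u => u • latticePoint d + v) d where
  continuous := by fun_prop
  mk_apply u := by
    rw [torusMk_add]
    refine congrArg (· + torusMk v) (Prod.ext ?_ ?_)
    · change ((u * d.1 : ℝ) : UnitAddCircle) = d.1 • (u : UnitAddCircle)
      rw [← AddCircle.coe_zsmul, zsmul_eq_mul, mul_comm]
    · change ((u * d.2 : ℝ) : UnitAddCircle) = d.2 • (u : UnitAddCircle)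
      rw [← AddCircle.coe_zsmul, zsmul_eq_mul, mul_comm]
  add_one u := by
    rw [add_smul, one_smul]
    abel

theorem hasDerivAt_line (x v : ℝ × ℝ) (u : ℝ) : HasDerivAt (fun u : ℝ => u • x + v) x u := by
  simpa using ((hasDerivAt_id u).smul_const x).add_const v

theorem isSmoothLoop_linearLoop (d : ℤ × ℤ) (v : ℝ × ℝ) :
    IsSmoothLoop (linearLoop d (torusMk v)) :=
  (isLift_linearLoop d v).isSmoothLoop_iff.2 (by fun_prop)

theorem exists_orthogonal_lattice (d e : ℤ × ℤ) (h : d.1 * e.2 - d.2 * e.1 = 0) :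
    ∃ n : ℤ × ℤ, n ≠ 0 ∧ n.1 * d.1 + n.2 * d.2 = 0 ∧ n.1 * e.1 + n.2 * e.2 = 0 := by
  by_cases hd : d = 0
  · by_cases he : e = 0
    · exact ⟨(1, 0), by simp, by simp [hd], by simp [he]⟩
    · refine ⟨(-e.2, e.1), fun h0 => he ?_, by simp [hd], by ring⟩
      simp only [Prod.ext_iff, Prod.fst_zero, Prod.snd_zero, neg_eq_zero] at h0 ⊢
      exact h0.symm
  · refine ⟨(-d.2, d.1), fun h0 => hd ?_, by ring, by linarith⟩
    simp only [Prod.ext_iff, Prod.fst_zero, Prod.snd_zero, neg_eq_zero] at h0 ⊢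
    exact h0.symm

/-- Two linear loops on the torus are transverse for a suitable translation of the second. -/
theorem exists_areTransverse_linearLoop (d e : ℤ × ℤ) :
    ∃ v : ℝ × ℝ, AreTransverse (linearLoop d (torusMk 0)) (linearLoop e (torusMk v)) := by
  have hcross : ∀ (v p : ℝ × ℝ), crossing (linearLoop d (torusMk 0)) (linearLoop e (torusMk v))
      (torusMk p).1 (torusMk p).2 = ((d.1 * e.2 - d.2 * e.1 : ℤ) : ℝ) := fun v p => by
    rw [(isLift_linearLoop d 0).crossing_eq (isLift_linearLoop e v) (hasDerivAt_line _ _)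
      (hasDerivAt_line _ _)]
    simp only [jacobian, latticePoint, Pi.neg_apply, Prod.fst_neg, Prod.snd_neg]
    push_cast
    ring
  by_cases hde : d.1 * e.2 - d.2 * e.1 = 0
  · obtain ⟨n, hn, hnd, hne⟩ := exists_orthogonal_lattice d e hde
    have hpos : (n.1 : ℝ) ^ 2 + (n.2 : ℝ) ^ 2 ≠ 0 := by
      intro h0
      apply hn
      have h1 : (n.1 : ℝ) = 0 := by nlinarith [sq_nonneg (n.1 : ℝ), sq_nonneg (n.2 : ℝ)]
      have h2 : (n.2 : ℝ) = 0 := by nlinarith [sq_nonneg (n.1 : ℝ), sq_nonneg (n.2 : ℝ)]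
      exact Prod.ext (by exact_mod_cast h1) (by exact_mod_cast h2)
    -- The shift `n / (2 |n|²)` has scalar product 1/2 with `n`, which is orthogonal to both
    -- directions. At an intersection, pairing with `n` would make -1/2 an integer, so the loops are
    -- disjoint and transversality is vacuous.
    refine ⟨(2 * ((n.1 : ℝ) ^ 2 + (n.2 : ℝ) ^ 2))⁻¹ • latticePoint n,
      isSmoothLoop_linearLoop _ _, isSmoothLoop_linearLoop _ _, fun x hx => ?_⟩
    exfalso
    obtain ⟨p, -, rfl⟩ := exists_mem_unitSquare 0 x
    obtain ⟨z, hz⟩ := (torusMk_eq_zero_iff _).1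
      (((isLift_linearLoop d 0).torusMk_mem_intersections (isLift_linearLoop e _) p).1 hx)
    have h1 := congrArg Prod.fst hz
    have h2 := congrArg Prod.snd hz
    simp only [latticePoint, Pi.neg_apply, Prod.fst_add, Prod.snd_add, Prod.fst_neg, Prod.snd_neg,
      Prod.smul_fst, Prod.smul_snd, smul_eq_mul, add_zero] at h1 h2
    have hnd' : (n.1 : ℝ) * d.1 + n.2 * d.2 = 0 := by exact_mod_cast hnd
    have hne' : (n.1 : ℝ) * e.1 + n.2 * e.2 = 0 := by exact_mod_cast hne
    have hinv : (2 * ((n.1 : ℝ) ^ 2 + (n.2 : ℝ) ^ 2))⁻¹ * ((n.1 : ℝ) ^ 2 + (n.2 : ℝ) ^ 2) =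
        1 / 2 := by
      field_simp
    have hhalf : (2 : ℝ) * (n.1 * z.1 + n.2 * z.2) = -1 := by
      linear_combination (-2 * (n.1 : ℝ)) * h1 - 2 * (n.2 : ℝ) * h2 + 2 * p.1 * hnd' -
        2 * p.2 * hne' - 2 * hinv
    have hodd : (2 : ℤ) * (n.1 * z.1 + n.2 * z.2) = -1 := by exact_mod_cast hhalf
    omega
  -- For independent directions the crossing determinant is a nonzero constant, so no shift is
  -- needed.
  · refine ⟨0, isSmoothLoop_linearLoop _ _, isSmoothLoop_linearLoop _ _, fun x _ => ?_⟩
    obtain ⟨p, -, rfl⟩ := exists_mem_unitSquare 0 x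
    rw [hcross]
    exact_mod_cast hde

theorem exists_areTransverse (x y : FreeLoopClass Torus) :
    ∃ α β : Loop Torus, freeClass α = x ∧ freeClass β = y ∧ AreTransverse α β := by
  obtain ⟨v, hv⟩ := exists_areTransverse_linearLoop (classDegree x) (classDegree y)
  exact ⟨_, _, classDegree_injective (isLift_linearLoop _ _).loopDegree_eq,
    classDegree_injective (isLift_linearLoop _ _).loopDegree_eq, hv⟩

theorem bracket_single_word (R : Type*) [CommRing R] (i j k l : ℤ) :
    bracket R Torus (Finsupp.single (word i j) 1) (Finsupp.single (word k l) 1) =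
      ((i * l - j * k : ℤ) : R) • Finsupp.single (word (i + k) (j + l)) 1 := by
  have h : ∃ q : Loop Torus × Loop Torus,
      freeClass q.1 = word i j ∧ freeClass q.2 = word k l ∧ AreTransverse q.1 q.2 :=
    let ⟨α, β, h⟩ := exists_areTransverse (word i j) (word k l)
    ⟨(α, β), h⟩
  rw [bracket, Finsupp.linearCombination_single, one_smul, Finsupp.linearCombination_single,
    one_smul, bracketOfClasses, dif_pos h]
  -- The choice of representatives in `bracketOfClasses` is immaterial, since every transverse pair
  -- yields this value.
  exact h.choose_spec.2.2.intersectionSum_eq R h.choose_spec.1 h.choose_spec.2.1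

end Goldman

theorem mainTheorem9 (R : Type*) [CommRing R] :
    -- any two free homotopy classes have transverse representatives
    (∀ x y : Goldman.FreeLoopClass Goldman.Torus, ∃ α β : Goldman.Loop Goldman.Torus,
      Goldman.freeClass α = x ∧ Goldman.freeClass β = y ∧ Goldman.AreTransverse α β) ∧
    -- the bracket can be computed from every pair of transverse representatives
    (∀ α β : Goldman.Loop Goldman.Torus, Goldman.AreTransverse α β →
      (Goldman.intersections α β).Finite ∧
      Goldman.bracket R Goldman.Torus (Finsupp.single (Goldman.freeClass α) 1)
        (Finsupp.single (Goldman.freeClass β) 1) = Goldman.intersectionSum R α β) ∧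
    -- the words `a ^ i * b ^ j` represent each free homotopy class exactly once
    Function.Bijective (fun p : ℤ × ℤ => Goldman.word p.1 p.2) ∧
    -- the bracket of two such classes
    ∀ i j k l : ℤ,
      Goldman.bracket R Goldman.Torus (Finsupp.single (Goldman.word i j) 1)
        (Finsupp.single (Goldman.word k l) 1) =
      ((i * l - j * k : ℤ) : R) • Finsupp.single (Goldman.word (i + k) (j + l)) 1 := by
  refine ⟨Goldman.exists_areTransverse, fun α β H => ⟨H.finite_intersections, ?_⟩,
    Goldman.word_bijective, Goldman.bracket_single_word R⟩
  rw [← Goldman.word_loopDegree α, ← Goldman.word_loopDegree β, Goldman.bracket_single_word,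
    H.intersectionSum_eq R (Goldman.word_loopDegree α).symm (Goldman.word_loopDegree β).symm]
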